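/- Let $\mathcal A$ be a totally ordered alphabet with a smallest letter $a_1$, and let $p=(p_a)_{a\in\mathcal A}$ be a (discrete) probability distribution on $\mathcal A$ such that $p_1:=p_{a_1}$ satisfies $0<p_1<1$. Words are compared in the lexicographic order. The weight of a word $w=w_1\cdots w_n$ is $p(w)=p_{w_1}\cdots p_{w_n}$. The necklace of $w$ is the set of its cyclic permutations; $w$ is primitive if its necklace has exactly $n$ elements, and a Lyndon word is a primitive word that is minimal in its necklace. Let $\mathcal L_n$ be the set of Lyndon words with $n$ letters, and let $\mathbb L_n$ be the probability measure on $\mathcal L_n$ proportional to the weight, $$\mathbb L_n(\{w\})=\frac{p(w)}{\sum_{v\in\mathcal L_n}p(v)},\qquad w\in\mathcal L_n,\ n\ge 1,$$ (the denominator is positive). For $n\ge 2$ and $w\in\mathcal L_n$, the standard right factor of $w$ is the smallest nonempty proper suffix of $w$ in the lexicographic order; let $R_n(w)$ be its length and $r_n(w)=R_n(w)/n$. Then, as $n\to\infty$, the law $\mu_n$ of $r_n$ under $\mathbb L_n$ converges weakly to $$\mu(dx)=p_1\,\delta_1(dx)+(1-p_1)\,\mathbf 1_{[0,1)}(x)\,dx,$$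 where $\delta_1$ is the Dirac mass at $1$ and $dx$ is the Lebesgue measure on $\mathbb R$. For each $k\in\mathbb N$ the $k$-th moment of $r_n$ under $\mathbb L_n$ converges to the $k$-th moment of $\mu$. Moreover, for each $\varepsilon\in(0,1/2)$ there is a constant $C$, depending only on $\varepsilon$ and on $(\mathcal A,p)$, such that for all $n\ge 2$ $$\mathcal W_2(\mu_n,\mu)\le C\,n^{-1/2+\varepsilon}\log n,$$ where $\mathcal W_2(\mu,\nu)=\inf\mathbb E\big[|X-Y|^2\big]^{1/2}$ is the $L_2$-Wasserstein metric, the infimum being over all couplings $(X,Y)$ of $\mu$ and $\nu$. -/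

import Mathlib

open MeasureTheory ProbabilityTheory Filter Topology
open scoped ENNReal

namespace LyndonWord

/-! ### Words

A word on the totally ordered alphabet `A` is a `List A`; words are compared through the
lexicographic order (the order on `List A` provided by Mathlib, in which a proper prefix of a word
is smaller than this word). -/

section Words

variable {A : Type*}

/-- The necklace of a word: its orbit under cyclic permutations of the letters. -/
def necklace (w : List A) : Set (List A) := {v | v.IsRotated w}

/-- A word is primitive if its necklace has exactly as many elements as the word has letters.
The empty word is not primitive. -/
def IsPrimitive (w : List A) : Prop := (necklace w).ncard = w.length

/-- The nonempty proper suffixes of a word. -/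
def properSuffixes (w : List A) : Set (List A) := {v | v <:+ w ∧ v ≠ [] ∧ v ≠ w}

variable [LinearOrder A]

/-- A Lyndon word is a primitive word that is minimal in its necklace. -/
def IsLyndon (w : List A) : Prop := IsPrimitive w ∧ IsLeast (necklace w) w

/-- The set of Lyndon words with `n` letters. -/
def lyndonWords (A : Type*) [LinearOrder A] (n : ℕ) : Set (List A) :=
  {w | w.length = n ∧ IsLyndon w}

theorem exists_isLeast_properSuffixes {w : List A} (hw : 2 ≤ w.length) :
    ∃ v, IsLeast (properSuffixes w) v := by
  have hfin : (properSuffixes w).Finite :=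
    (List.finite_toSet w.tails).subset fun v hv => (List.mem_tails v w).2 hv.1
  have hne : (properSuffixes w).Nonempty := by
    refine ⟨w.tail, List.tail_suffix w, ?_, ?_⟩
    · intro h
      have := congrArg List.length h
      simp at this
      omega
    · intro h
      have := congrArg List.length h
      simp at this
      omega
  obtain ⟨v, hv, hmin⟩ := hfin.exists_minimal hne
  refine ⟨v, hv, fun u hu => ?_⟩
  rcases le_total v u with h | h
  · exact h
  · exact hmin hu h

/-- The standard right factor of a word with at least two letters: the smallest of its nonempty
proper suffixes in the lexicographic order. -/
noncomputable def standardRightFactor (w : List A) : List A :=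
  Classical.epsilon fun v => IsLeast (properSuffixes w) v

theorem isLeast_standardRightFactor {w : List A} (hw : 2 ≤ w.length) :
    IsLeast (properSuffixes w) (standardRightFactor w) :=
  Classical.epsilon_spec (exists_isLeast_properSuffixes hw)

/-- The normalized length of the standard right factor of a word. -/
noncomputable def normalizedLength (w : List A) : ℝ :=
  (standardRightFactor w).length / w.length

end Words

/-! ### Random words and random Lyndon words -/

section RandomWords

variable {A : Type*}

/-- The weight of a word: the product of the probabilities of its letters. -/
noncomputable def weight (p : PMF A) (w : List A) : ℝ≥0∞ := (w.map p).prod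

theorem exists_pmf_weight (p : PMF A) (n : ℕ) :
    ∃ q : PMF (List A), ∀ w, q w = if w.length = n then weight p w else 0 := by
  classical
  induction n with
  | zero =>
    refine ⟨PMF.pure [], fun w => ?_⟩
    cases w <;> simp [PMF.pure_apply, weight]
  | succ n ih =>
    obtain ⟨q, hq⟩ := ih
    refine ⟨p.bind fun a => q.map (List.cons a), fun w => ?_⟩
    cases w with
    | nil => simp [PMF.bind_apply, PMF.map_apply]
    | cons b u =>
      have key : ∀ a, (q.map (List.cons a)) (b :: u) = if a = b then q u else 0 := by
        intro a
        by_cases hab : a = b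
        · subst hab
          simp only [PMF.map_apply, List.cons.injEq, true_and, if_true]
          rw [tsum_eq_single u]
          · simp
          · intro v hv
            simp [Ne.symm hv]
        · simp [PMF.map_apply, hab, Ne.symm hab]
      rw [PMF.bind_apply, tsum_eq_single b]
      · rw [key b, hq u]
        by_cases hu : u.length = n <;> simp [hu, weight]
      · intro a ha
        rw [key a, if_neg ha, mul_zero]

/-- The law of a random word with `n` independent letters distributed according to `p`: each word
with `n` letters has a probability equal to its weight. -/
noncomputable def wordPMF (p : PMF A) (n : ℕ) : PMF (List A) :=
  ⟨fun w => if w.length = n then weight p w else 0, by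
    obtain ⟨q, hq⟩ := exists_pmf_weight p n
    rw [← funext hq]
    exact q.hasSum_coe_one⟩

/-- Every set of words is measurable. -/
instance instMeasurableSpaceWord : MeasurableSpace (List A) := ⊤

/-- The law of a random Lyndon word with `n` letters: the law of a random word with `n` letters,
conditioned to be a Lyndon word. It charges only Lyndon words with `n` letters, with a probability
proportional to the weight. -/
noncomputable def lyndonMeasure [LinearOrder A] (p : PMF A) (n : ℕ) : Measure (List A) :=
  (wordPMF p n).toMeasure[|lyndonWords A n]

/-- The law of the normalized length of the standard right factor of a random Lyndon word with `n`
letters. -/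
noncomputable def rightFactorLaw [LinearOrder A] (p : PMF A) (n : ℕ) : FiniteMeasure ℝ :=
  ⟨(lyndonMeasure p n).map normalizedLength, by
    unfold lyndonMeasure
    infer_instance⟩

end RandomWords

/-! ### The limit law and the Wasserstein metric -/

/-- The law `p₁ δ₁(dx) + (1 - p₁) 1_{[0,1)}(x) dx` on the real line. -/
noncomputable def limitLaw (p₁ : ℝ≥0∞) (hp₁ : p₁ ≤ 1) : FiniteMeasure ℝ :=
  ⟨p₁ • Measure.dirac 1 + (1 - p₁) • volume.restrict (Set.Ico 0 1), by
    constructor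
    simp only [Measure.add_apply, Measure.smul_apply, smul_eq_mul, measure_univ, mul_one,
      Measure.restrict_apply_univ, Real.volume_Ico, sub_zero, ENNReal.ofReal_one]
    rw [add_tsub_cancel_of_le hp₁]
    exact ENNReal.one_lt_top⟩

/-- The couplings of two measures on the real line. -/
def couplings (μ ν : Measure ℝ) : Set (Measure (ℝ × ℝ)) := {π | π.fst = μ ∧ π.snd = ν}

/-- The `L²`-Wasserstein distance between two probability measures on the real line: the infimum
over all couplings `(X, Y)` of the `L²`-norm of `X - Y`. -/
noncomputable def wasserstein2 (μ ν : Measure ℝ) : ℝ≥0∞ :=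
  ⨅ π ∈ couplings μ ν, (∫⁻ z, ENNReal.ofReal (|z.1 - z.2| ^ 2) ∂π) ^ (1 / 2 : ℝ)

end LyndonWord

/-! Place the letters on a circle. For a random circular word `x` with independent letters, let `i`
and `j` start its smallest and second smallest rotations. The Lyndon word of the necklace is read
from `i`, and its smallest proper suffix starts at `j`, because suffixes of a Lyndon word are
ordered like its rotations (`IsLyndon.rotate_lt_rotate`). So the right factor has length `(i -
j).val`, and rotation invariance identifies the law of this length under the Lyndon measure with the
law of `(i - j).val` given that all rotations are distinct (`lyndonMeasure_real_length`). Rotations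
are distinct with high probability, since windows of logarithmic length are rarely repeated
(`measureReal_not_injective_window_le`).

The atom comes from `j = i + 1`, where the left factor is a single letter. Prepending the smallest
letter to a Lyndon word with at least two letters always gives such a word; prepending another
letter does so only if the smallest letter is absent, which is exponentially unlikely. Comparing
Lyndon words of lengths `k` and `k + 1` gives the probability, close to `p a`
(`measureReal_consecutive_bounds`).

Otherwise the position of `j` relative to `i` is nearly uniform. Cut the circle into about `√n`
blocks of length about `√n`. Outside `badWords`, both rotations are identified by short windows
contained in blocks. Exchanging two blocks preserves the law and carries these windows along, so for
a fixed block of one position all other blocks are equally likely for the other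
(`measureReal_isBlockPair_fst_le`, `measureReal_isBlockPair_snd_le`). Both positions can share a
block without being consecutive only if two disjoint runs of the smallest letter, of near maximal
length, start there or if no long run exists; this is rare (`measureReal_isLowestPair_mem_le`).

These estimates give only upper bounds, but applied to `i - j` and to `j - i` they control the
distribution function from both sides (`lyndonMeasure_real_length_bounds`). The rate collects
windows crossing block boundaries, of order `n^(-1/2) log n`, and pairs in one block, of order
`n^(-1/2 + ε)`.

Finally, coupling the two laws through their quantile functions turns the estimate into a uniform
bound (`exists_quantile_bound`). This bounds the Wasserstein distance and, by dominated convergence,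
gives the limits of integrals of all continuous functions, hence weak convergence and convergence of
moments. -/

namespace LyndonWord

/-! ### Necklaces and suffixes -/

section Necklaces

variable {A : Type*}

theorem mem_necklace_rotate (w : List A) (k : ℕ) : w.rotate k ∈ necklace w :=
  List.IsRotated.symm ⟨k, rfl⟩

theorem necklace_eq_image (w : List A) (hw : w ≠ []) :
    necklace w = w.rotate '' (Finset.range w.length : Set ℕ) := by
  ext v
  simp only [necklace, Set.mem_ofPred_eq, Finset.coe_range, Set.mem_image, Set.mem_Iio]
  constructor
  · intro h
    obtain ⟨k, hk⟩ := h.symm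
    exact ⟨k % w.length, Nat.mod_lt _ (List.length_pos_of_ne_nil hw), by rw [List.rotate_mod, hk]⟩
  · rintro ⟨k, -, rfl⟩
    exact mem_necklace_rotate w k

theorem isPrimitive_iff_injOn {w : List A} (hw : w ≠ []) :
    IsPrimitive w ↔ Set.InjOn w.rotate (Finset.range w.length : Set ℕ) := by
  unfold IsPrimitive
  rw [necklace_eq_image w hw]
  constructor
  · intro h
    refine Set.injOn_of_ncard_image_eq ?_ (Finset.finite_toSet _)
    rw [h, Set.ncard_coe_finset, Finset.card_range]
  · intro h
    rw [h.ncard_image, Set.ncard_coe_finset, Finset.card_range]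

theorem ne_nil_of_isPrimitive {w : List A} (h : IsPrimitive w) : w ≠ [] := by
  rintro rfl
  have : necklace ([] : List A) = {[]} := by
    ext v; simp [necklace]
  simp [IsPrimitive, this] at h

theorem mem_properSuffixes_iff {w v : List A} :
    v ∈ properSuffixes w ↔ ∃ u, u ≠ [] ∧ v ≠ [] ∧ u ++ v = w := by
  constructor
  · rintro ⟨⟨u, hu⟩, hv, hvw⟩
    refine ⟨u, ?_, hv, hu⟩
    rintro rfl
    exact hvw (by simpa using hu)
  · rintro ⟨u, hu, hv, rfl⟩
    exact ⟨List.suffix_append u v, hv, fun h => hu (by simpa using h)⟩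

theorem mem_properSuffixes_iff_drop {w v : List A} :
    v ∈ properSuffixes w ↔ ∃ k, 0 < k ∧ k < w.length ∧ v = w.drop k := by
  rw [mem_properSuffixes_iff]
  constructor
  · rintro ⟨u, hu, hv, rfl⟩
    refine ⟨u.length, List.length_pos_of_ne_nil hu, ?_, by simp⟩
    have := List.length_pos_of_ne_nil hv
    simp [this]
  · rintro ⟨k, hk, hkw, rfl⟩
    refine ⟨w.take k, ?_, ?_, List.take_append_drop k w⟩
    · rw [Ne, List.take_eq_nil_iff]
      rintro (h | h)
      · omega
      · subst h; simp at hkw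
    · simpa using hkw

end Necklaces

/-! ### Lexicographic comparison of words -/

section Lists

variable {A : Type*} [LinearOrder A]

/-- Unless one word is a prefix of the other, the comparison is decided at a letter present in both,
and nothing appended afterwards matters. -/
theorem isPrefix_or_append_lt_append {u v : List A} (h : u < v) :
    u <+: v ∨ ∀ x y, u ++ x < v ++ y := by
  induction u generalizing v with
  | nil => exact Or.inl (List.nil_prefix)
  | cons a u ih =>
    cases v with
    | nil => exact absurd h (List.not_lt_nil _)
    | cons b v =>
      rcases List.cons_lt_cons_iff.1 h with hab | ⟨rfl, huv⟩
      · exact Or.inr fun x y => List.cons_lt_cons_iff.2 (Or.inl hab)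
      · rcases ih huv with hp | hl
        · exact Or.inl ((List.prefix_cons_inj a).2 hp)
        · exact Or.inr fun x y => List.cons_lt_cons_iff.2 (Or.inr ⟨rfl, hl x y⟩)

theorem append_lt_append_iff_right {s u v : List A} : s ++ u < s ++ v ↔ u < v := by
  induction s with
  | nil => simp
  | cons a s ih => simpa using ih

theorem append_lt_append_of_length_eq {u v : List A} (h : u < v) (hl : u.length = v.length)
    (x y : List A) : u ++ x < v ++ y := by
  rcases isPrefix_or_append_lt_append h with hp | hp
  · exact absurd (hp.eq_of_length hl) h.ne
  · exact hp x y

theorem le_of_isPrefix {u v : List A} (h : u <+: v) : u ≤ v := not_lt.1 (List.IsPrefix.le h)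

theorem self_le_append (u v : List A) : u ≤ u ++ v := le_of_isPrefix (List.prefix_append u v)

/-! ### Lyndon words and their suffixes -/

/-- Write `w = u ++ v`; minimality and primitivity give `u ++ v < v ++ u`. If `v < u ++ v` were
decided at a letter of `v`, this would be reversed. If instead `u ++ v = v ++ y`, then cancelling
`v` gives `y < u`, and the rotation `y ++ v` would be smaller than `w`. -/
theorem IsLyndon.lt_of_mem_properSuffixes {w v : List A} (hw : IsLyndon w)
    (hv : v ∈ properSuffixes w) : w < v := by
  have hne := ne_nil_of_isPrimitive hw.1
  obtain ⟨u, hu, hv0, rfl⟩ := mem_properSuffixes_iff.1 hv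
  have hul := List.length_pos_of_ne_nil hu
  have hvl := List.length_pos_of_ne_nil hv0
  have hrot : u ++ v < v ++ u := by
    refine lt_of_le_of_ne ?_ ?_
    · have := hw.2.2 (mem_necklace_rotate (u ++ v) u.length)
      rwa [List.rotate_append_length_eq] at this
    · intro h
      have := (isPrimitive_iff_injOn hne).1 hw.1 (x₁ := 0) (x₂ := u.length)
        (by simp; omega) (by simp; omega) (by simpa [List.rotate_append_length_eq] using h)
      omega
  by_contra hcon
  have hlt : v < u ++ v := lt_of_le_of_ne (not_lt.1 hcon) fun h => hu (by simpa using h)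
  rcases isPrefix_or_append_lt_append hlt with ⟨y, hy⟩ | h
  · have hlen : y.length = u.length := by
      have := congrArg List.length hy
      simp at this; omega
    rw [← hy, append_lt_append_iff_right] at hrot
    have h1 := append_lt_append_of_length_eq hrot hlen v v
    have h2 := hw.2.2 (mem_necklace_rotate (u ++ v) v.length)
    rw [← hy, List.rotate_append_length_eq, hy] at h2
    exact absurd h1 (not_lt.2 h2)
  · have := h u []
    rw [List.append_nil] at this
    exact absurd this hrot.asymm

theorem lt_rotate_of_forall_lt {w : List A} (h : ∀ v ∈ properSuffixes w, w < v) {k : ℕ}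
    (hk : 0 < k) (hkw : k < w.length) : w < w.rotate k := by
  rw [List.rotate_eq_drop_append_take hkw.le]
  exact (h _ (mem_properSuffixes_iff_drop.2 ⟨k, hk, hkw, rfl⟩)).trans_le (self_le_append _ _)

theorem isLyndon_of_forall_lt {w : List A} (hw : w ≠ [])
    (h : ∀ v ∈ properSuffixes w, w < v) : IsLyndon w := by
  refine ⟨(isPrimitive_iff_injOn hw).2 ?_, List.IsRotated.refl w, ?_⟩
  · have key : ∀ k l : ℕ, k < l → l < w.length → w.rotate k ≠ w.rotate l := by
      intro k l hkl hl heq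
      have h1 : w.rotate l = (w.rotate (l - k)).rotate k := by
        rw [List.rotate_rotate]; congr 1; omega
      rw [h1, List.rotate_eq_rotate] at heq
      exact (lt_rotate_of_forall_lt h (by omega : 0 < l - k) (by omega)).ne heq
    intro k hk l hl heq
    simp only [Finset.coe_range, Set.mem_Iio] at hk hl
    rcases lt_trichotomy k l with hlt | rfl | hlt
    · exact absurd heq (key k l hlt hl)
    · rfl
    · exact absurd heq.symm (key l k hlt hk)
  · intro v hv
    rw [necklace_eq_image w hw] at hv
    obtain ⟨k, hk, rfl⟩ := hv
    simp only [Finset.coe_range, Set.mem_Iio] at hk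
    rcases Nat.eq_zero_or_pos k with rfl | hk0
    · simp
    · exact (lt_rotate_of_forall_lt h hk0 hk).le

theorem isLyndon_iff_forall_lt {w : List A} :
    IsLyndon w ↔ w ≠ [] ∧ ∀ v ∈ properSuffixes w, w < v :=
  ⟨fun h => ⟨ne_nil_of_isPrimitive h.1, fun _ => h.lt_of_mem_properSuffixes⟩,
    fun h => isLyndon_of_forall_lt h.1 h.2⟩

/-- For proper suffixes of a Lyndon word, the order of the suffixes is the order of the
corresponding rotations. -/
theorem IsLyndon.rotate_lt_rotate {w : List A} (hw : IsLyndon w) {s t : ℕ}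
    (hsw : s < w.length) (ht : t < w.length)
    (h : w.drop t < w.drop s) : w.rotate t < w.rotate s := by
  rw [List.rotate_eq_drop_append_take hsw.le, List.rotate_eq_drop_append_take ht.le]
  rcases isPrefix_or_append_lt_append h with ⟨y, hy⟩ | h
  -- When one suffix is a prefix of the other, the remainder `y` is itself a proper suffix of `w`,
  -- hence exceeds `w` and all its prefixes.
  · rw [← hy, List.append_assoc, append_lt_append_iff_right]
    have hy0 : y ≠ [] := by
      rintro rfl
      rw [List.append_nil] at hy
      exact h.ne hy
    have hyw : y ∈ properSuffixes w := by
      refine mem_properSuffixes_iff.2 ⟨w.take s ++ w.drop t, ?_, hy0, ?_⟩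
      · simp; omega
      · rw [List.append_assoc, hy, List.take_append_drop]
    calc w.take t ≤ w := le_of_isPrefix (List.take_prefix t w)
      _ < y := hw.lt_of_mem_properSuffixes hyw
      _ ≤ y ++ w.take s := self_le_append _ _
  · exact h _ _

theorem standardRightFactor_eq_of_isLeast {w v : List A} (h : IsLeast (properSuffixes w) v) :
    standardRightFactor w = v := by
  have hs : IsLeast (properSuffixes w) (standardRightFactor w) := Classical.epsilon_spec ⟨v, h⟩
  exact hs.unique h

theorem IsLyndon.standardRightFactor_eq {w : List A} (hw : IsLyndon w) {s : ℕ} (hs : 0 < s)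
    (hsw : s < w.length)
    (h : ∀ t, 0 < t → t < w.length → w.rotate s ≤ w.rotate t) :
    standardRightFactor w = w.drop s := by
  refine standardRightFactor_eq_of_isLeast
    ⟨mem_properSuffixes_iff_drop.2 ⟨s, hs, hsw, rfl⟩, fun v hv => ?_⟩
  obtain ⟨t, ht, htw, rfl⟩ := mem_properSuffixes_iff_drop.1 hv
  by_contra hcon
  exact absurd (h t ht htw) (not_le.2 (hw.rotate_lt_rotate hsw htw (not_le.1 hcon)))

theorem properSuffixes_cons (c : A) {v : List A} (hv : v ≠ []) :
    properSuffixes (c :: v) = insert v (properSuffixes v) := by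
  ext u
  simp only [properSuffixes, Set.mem_ofPred_eq, Set.mem_insert_iff, List.suffix_cons_iff]
  constructor
  · rintro ⟨h1 | h1, h2, h3⟩
    · exact absurd h1 h3
    · by_cases huv : u = v
      · exact Or.inl huv
      · exact Or.inr ⟨h1, h2, huv⟩
  · rintro (rfl | ⟨h1, h2, h3⟩)
    · exact ⟨Or.inr (List.suffix_refl _), hv, by simp⟩
    · refine ⟨Or.inr h1, h2, fun h => ?_⟩
      have := h1.length_le
      rw [h] at this
      simp at this

/-- The proper suffixes of `c :: v` are `v` and those of `v`, so `v` is the least of them exactly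
when `v` is Lyndon. -/
theorem isLyndon_cons_and_standardRightFactor_eq_iff {c : A} {v : List A} (hv : v ≠ []) :
    IsLyndon (c :: v) ∧ standardRightFactor (c :: v) = v ↔ IsLyndon v ∧ c :: v < v := by
  have hlen : 2 ≤ (c :: v).length := by
    have := List.length_pos_of_ne_nil hv
    simp; omega
  rw [isLyndon_iff_forall_lt, isLyndon_iff_forall_lt, properSuffixes_cons c hv]
  constructor
  · rintro ⟨⟨-, h⟩, hs⟩
    have hl := isLeast_standardRightFactor hlen
    rw [hs, properSuffixes_cons c hv] at hl
    refine ⟨⟨hv, fun u hu => lt_of_le_of_ne (hl.2 (Set.mem_insert_of_mem _ hu)) ?_⟩,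
      h v (Set.mem_insert _ _)⟩
    rintro rfl
    exact hu.2.2 rfl
  · rintro ⟨⟨-, h⟩, hc⟩
    refine ⟨⟨by simp, ?_⟩, standardRightFactor_eq_of_isLeast ?_⟩
    · rintro u (rfl | hu)
      · exact hc
      · exact hc.trans (h u hu)
    · rw [properSuffixes_cons c hv]
      refine ⟨Set.mem_insert _ _, ?_⟩
      rintro u (rfl | hu)
      · exact le_rfl
      · exact (h u hu).le

theorem IsLyndon.cons_lt {a : A} (ha : ∀ b, a ≤ b) {v : List A} (hv : IsLyndon v)
    (hlen : 2 ≤ v.length) : a :: v < v := by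
  obtain ⟨d, u, rfl⟩ := List.exists_cons_of_ne_nil (ne_nil_of_isPrimitive hv.1)
  have hu : u ≠ [] := by rintro rfl; simp at hlen
  rcases (ha d).lt_or_eq with h | rfl
  · exact List.cons_lt_cons_iff.2 (Or.inl h)
  · refine List.cons_lt_cons_iff.2 (Or.inr ⟨rfl, hv.lt_of_mem_properSuffixes ?_⟩)
    rw [properSuffixes_cons _ hu]
    exact Set.mem_insert _ _

/-- The comparison forces the first letter of `v` to be at least `c`, hence above `a`; a suffix of
`v` starting with `a` would then be smaller than `v`. -/
theorem IsLyndon.notMem_of_cons_lt {a : A} (ha : ∀ b, a ≤ b) {c : A} (hc : c ≠ a) {v : List A}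
    (hv : IsLyndon v) (h : c :: v < v) : a ∉ v := by
  obtain ⟨d, u, rfl⟩ := List.exists_cons_of_ne_nil (ne_nil_of_isPrimitive hv.1)
  have hd : a < d := by
    have hca : a < c := lt_of_le_of_ne (ha c) hc.symm
    rcases List.cons_lt_cons_iff.1 h with h | ⟨h, -⟩
    · exact hca.trans h
    · exact h ▸ hca
  intro hmem
  rcases List.mem_cons.1 hmem with h | h
  · exact hd.ne h
  obtain ⟨s, t, rfl⟩ := List.append_of_mem h
  have := hv.lt_of_mem_properSuffixes (v := a :: t)
    (mem_properSuffixes_iff.2 ⟨d :: s, by simp, by simp, by simp⟩)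
  rcases List.cons_lt_cons_iff.1 this with h | ⟨h, -⟩
  · exact absurd h hd.asymm
  · exact hd.ne h.symm

/-- With a letter `b` of positive probability, this word shows that the normalizing constant of the
Lyndon measure is positive. -/
theorem isLyndon_replicate_append {a b : A} (hab : a < b) (n : ℕ) :
    IsLyndon (List.replicate n a ++ [b]) := by
  refine isLyndon_of_forall_lt (by simp) fun v hv => ?_
  obtain ⟨k, h1, h2, rfl⟩ := mem_properSuffixes_iff_drop.1 hv
  simp only [List.length_append, List.length_replicate, List.length_singleton] at h2
  have hn : n = (n - k) + ((k - 1) + 1) := by omega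
  rw [List.drop_append_of_le_length (by simp; omega), List.drop_replicate]
  conv_lhs => rw [hn, List.replicate_add, List.append_assoc]
  rw [append_lt_append_iff_right, List.replicate_succ, List.cons_append]
  exact List.cons_lt_cons_iff.2 (Or.inl hab)

end Lists

/-! ### Circular words -/

section CircularWords

variable {A : Type*} {n : ℕ}

instance instMeasurableSpaceCircularWord : MeasurableSpace (ZMod n → A) := ⊤

theorem bijective_natCast_fin [NeZero n] :
    Function.Bijective fun k : Fin n => ((k : ℕ) : ZMod n) := by
  rw [Fintype.bijective_iff_injective_and_card]
  refine ⟨fun k l h => Fin.ext ?_, by simp [ZMod.card]⟩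
  have := congrArg ZMod.val h
  simpa [ZMod.val_cast_of_lt k.2, ZMod.val_cast_of_lt l.2] using this

/-- The word read along a circular word, from the position `0`. -/
def toWord (x : ZMod n → A) : List A := List.ofFn fun k : Fin n => x (k : ℕ)

@[simp] theorem length_toWord (x : ZMod n → A) : (toWord x).length = n := by simp [toWord]

theorem wordPMF_apply (p : PMF A) (w : List A) :
    wordPMF p n w = if w.length = n then weight p w else 0 := rfl

variable [NeZero n]

theorem toWord_injective : Function.Injective (toWord : (ZMod n → A) → List A) := by
  intro x y h
  have h' := List.ofFn_injective h
  funext t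
  obtain ⟨k, rfl⟩ := bijective_natCast_fin.2 t
  exact congrFun h' k

theorem exists_toWord_eq {w : List A} (hw : w.length = n) : ∃ x : ZMod n → A, toWord x = w := by
  subst hw
  refine ⟨fun t => w[t.val]'(ZMod.val_lt t), ?_⟩
  refine List.ext_getElem (by simp) fun k h1 h2 => ?_
  simp [toWord, Nat.mod_eq_of_lt h2]

variable (p : PMF A)

theorem weight_toWord (x : ZMod n → A) : weight p (toWord x) = ∏ t, p (x t) := by
  rw [weight, toWord, List.map_ofFn, List.prod_ofFn]
  exact Fintype.prod_bijective _ bijective_natCast_fin _ _ fun k => rfl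

variable (n) in
/-- The law of a circular word with `n` independent letters distributed according to `p`. -/
noncomputable def circularPMF : PMF (ZMod n → A) :=
  ⟨fun x => ∏ t, p (x t), by
    have h := (wordPMF p n).hasSum_coe_one
    rw [← toWord_injective.hasSum_iff (f := fun w => wordPMF p n w) (g := toWord (n := n))] at h
    · convert h using 2 with x
      rw [Function.comp_apply, wordPMF_apply, if_pos (length_toWord x), weight_toWord]
    · intro w hw
      rw [wordPMF_apply, if_neg]
      exact fun h => hw (exists_toWord_eq h)⟩

theorem circularPMF_apply (x : ZMod n → A) : circularPMF n p x = ∏ t, p (x t) := rfl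

theorem circularPMF_eq (x : ZMod n → A) : circularPMF n p x = wordPMF p n (toWord x) := by
  rw [wordPMF_apply, if_pos (length_toWord x), weight_toWord, circularPMF_apply]

variable (n) in
/-- The law of a circular word with `n` independent letters distributed according to `p`. -/
noncomputable def circularMeasure : Measure (ZMod n → A) := (circularPMF n p).toMeasure

instance : IsProbabilityMeasure (circularMeasure n p) := by
  unfold circularMeasure; infer_instance

theorem circularMeasure_apply (S : Set (ZMod n → A)) :
    circularMeasure n p S = ∑' x, circularPMF n p x * S.indicator 1 x := by
  rw [circularMeasure, PMF.toMeasure_apply _ (MeasurableSpace.measurableSet_top)]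
  refine tsum_congr fun x => ?_
  by_cases h : x ∈ S <;> simp [h]

theorem wordPMF_toMeasure_apply (S : Set (List A)) :
    (wordPMF p n).toMeasure S = circularMeasure n p {x | toWord x ∈ S} := by
  rw [PMF.toMeasure_apply _ (MeasurableSpace.measurableSet_top), circularMeasure_apply,
    ← toWord_injective.tsum_eq (g := toWord (n := n))]
  · refine tsum_congr fun x => ?_
    by_cases h : toWord x ∈ S
    · simp [h, circularPMF_eq]
    · simp [h]
  · intro w hw
    by_contra hcon
    refine hw ?_
    rw [Set.indicator_apply_eq_zero]
    intro _
    rw [wordPMF_apply, if_neg]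
    exact fun h => hcon (exists_toWord_eq h)

/-- Exchangeability of independent letters: it serves both for rotations of the circle and for
exchanges of blocks. -/
theorem circularMeasure_preimage_perm (π : Equiv.Perm (ZMod n)) (S : Set (ZMod n → A)) :
    circularMeasure n p {x | x ∘ π ∈ S} = circularMeasure n p S := by
  rw [circularMeasure_apply, circularMeasure_apply,
    ← (Equiv.arrowCongr π.symm (Equiv.refl A)).tsum_eq
      (fun x => circularPMF n p x * S.indicator 1 x)]
  refine tsum_congr fun x => ?_
  have h1 : (Equiv.arrowCongr π.symm (Equiv.refl A)) x = x ∘ π := rfl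
  rw [h1]
  congr 1
  rw [circularPMF_apply, circularPMF_apply]
  exact (Equiv.prod_comp π fun t => p (x t)).symm

/-! ### Conditioning with respect to the letters at all positions but one -/

/-- Splitting off the coordinate `c` makes the weight a product; resampling that letter therefore
leaves expectations unchanged. -/
theorem tsum_circularPMF_mul (c : ZMod n) (f : (ZMod n → A) → ℝ≥0∞) :
    ∑' x, circularPMF n p x * f x =
      ∑' x, circularPMF n p x * ∑' a, p a * f (Function.update x c a) := by
  classical
  let e := Equiv.funSplitAt c A
  have hW : ∀ a y, circularPMF n p (e.symm (a, y)) = p a * ∏ j, p (y j) := by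
    intro a y
    rw [circularPMF_apply, Fintype.prod_eq_mul_prod_subtype_ne _ c]
    congr 1
    · simp [e, Equiv.funSplitAt, Equiv.piSplitAt]
    · refine Finset.prod_congr rfl fun j _ => ?_
      simp [e, Equiv.funSplitAt, Equiv.piSplitAt, j.2]
  have hup : ∀ a y b, Function.update (e.symm (a, y)) c b = e.symm (b, y) := by
    intro a y b
    funext t
    by_cases h : t = c
    · subst h; simp [e, Equiv.funSplitAt, Equiv.piSplitAt]
    · simp [e, Equiv.funSplitAt, Equiv.piSplitAt, h]
  rw [← e.symm.tsum_eq, ← e.symm.tsum_eq (fun x => circularPMF n p x * _), ENNReal.tsum_prod',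
    ENNReal.tsum_prod', ENNReal.tsum_comm, 
    ENNReal.tsum_comm (f := fun a b => circularPMF n p (e.symm (a, b)) * _)]
  refine tsum_congr fun y => ?_
  simp_rw [hup, hW]
  rw [ENNReal.tsum_mul_right, ENNReal.tsum_mul_right, p.tsum_coe, one_mul, ← ENNReal.tsum_mul_left]
  refine tsum_congr fun a => ?_
  ring

/-- A set of circular words that does not depend on the letter at the position `c`. -/
def InsensitiveAt (S : Set (ZMod n → A)) (c : ZMod n) : Prop :=
  ∀ x a, Function.update x c a ∈ S ↔ x ∈ S

variable {p}

theorem circularMeasure_inter_eq {S : Set (ZMod n → A)} {c : ZMod n} (hS : InsensitiveAt S c)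
    {φ : (ZMod n → A) → A} (hφ : ∀ x a, φ (Function.update x c a) = φ x) :
    circularMeasure n p (S ∩ {x | x c = φ x}) =
      ∑' x, circularPMF n p x * S.indicator (fun x => p (φ x)) x := by
  classical
  rw [circularMeasure_apply, tsum_circularPMF_mul p c]
  refine tsum_congr fun x => ?_
  congr 1
  rw [tsum_eq_single (φ x)]
  · by_cases h : x ∈ S
    · have h' := (hS x (φ x)).2 h
      simp [h, h', hφ]
    · have h' := mt (hS x (φ x)).1 h
      simp [h, h']
  · intro a ha
    have : Function.update x c a ∉ S ∩ {x | x c = φ x} := by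
      rintro ⟨-, h⟩
      simp only [Set.mem_ofPred_eq, Function.update_self, hφ] at h
      exact ha h
    simp [this]

theorem circularMeasure_inter_const {S : Set (ZMod n → A)} {c : ZMod n} (hS : InsensitiveAt S c)
    (a : A) : circularMeasure n p (S ∩ {x | x c = a}) = p a * circularMeasure n p S := by
  rw [circularMeasure_inter_eq hS (φ := fun _ => a) (fun _ _ => rfl), circularMeasure_apply,
    ← ENNReal.tsum_mul_left]
  refine tsum_congr fun x => ?_
  by_cases h : x ∈ S
  · simp [h, mul_comm]
  · simp [h]

/-- The target letter `φ` may be random, as long as it ignores the position `c`: conditionally on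
the other letters it is hit with probability at most `ρ`. -/
theorem circularMeasure_inter_le {S : Set (ZMod n → A)} {c : ZMod n} (hS : InsensitiveAt S c)
    {φ : (ZMod n → A) → A} (hφ : ∀ x a, φ (Function.update x c a) = φ x) {ρ : ℝ≥0∞}
    (hρ : ∀ a, p a ≤ ρ) :
    circularMeasure n p (S ∩ {x | x c = φ x}) ≤ ρ * circularMeasure n p S := by
  rw [circularMeasure_inter_eq hS hφ, circularMeasure_apply, ← ENNReal.tsum_mul_left]
  refine ENNReal.tsum_le_tsum fun x => ?_
  by_cases h : x ∈ S
  · simp only [h, Set.indicator_of_mem, Pi.one_apply, mul_one]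
    rw [mul_comm]
    gcongr
    exact hρ _
  · simp [h]

theorem circularMeasure_inter_cylinder {S : Set (ZMod n → A)} (U : Finset (ZMod n))
    (hS : ∀ c ∈ U, InsensitiveAt S c) (a : A) :
    circularMeasure n p (S ∩ {x | ∀ u ∈ U, x u = a}) = p a ^ U.card * circularMeasure n p S := by
  classical
  induction U using Finset.induction_on with
  | empty => simp
  | insert c U hc ih =>
    have h1 : S ∩ {x | ∀ u ∈ insert c U, x u = a} =
        (S ∩ {x | ∀ u ∈ U, x u = a}) ∩ {x | x c = a} := by
      ext x; simp; tauto
    have h2 : InsensitiveAt (S ∩ {x | ∀ u ∈ U, x u = a}) c := by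
      intro x b
      simp only [Set.mem_inter_iff, hS c (Finset.mem_insert_self c U) x b, Set.mem_ofPred_eq]
      refine and_congr_right fun _ => forall₂_congr fun u hu => ?_
      rw [Function.update_of_ne (ne_of_mem_of_not_mem hu hc)]
    rw [h1, circularMeasure_inter_const h2, ih fun c hc => hS c (Finset.mem_insert_of_mem hc),
      Finset.card_insert_of_notMem hc]
    ring

theorem circularMeasure_cylinder (U : Finset (ZMod n)) (a : A) :
    circularMeasure n p {x | ∀ u ∈ U, x u = a} = p a ^ U.card := by
  have := circularMeasure_inter_cylinder (p := p) (S := Set.univ) U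
    (fun c _ x b => by simp) a
  simpa using this

end CircularWords

/-! ### Rotations of a circular word -/

section Rotations

set_option linter.unusedSectionVars false

variable {A : Type*} [LinearOrder A] {n : ℕ}

/-- The infinite periodic word read along a circular word from the position `s`. -/
def rot (x : ZMod n → A) (s : ZMod n) : Lex (ℕ → A) := toLex fun k => x (s + (k : ℕ))

/-- The window of length `m` of a circular word, from the position `s`. -/
def window (m : ℕ) (x : ZMod n → A) (s : ZMod n) : Lex (Fin m → A) :=
  toLex fun k => x (s + (k : ℕ))

theorem rot_lt_iff {x : ZMod n → A} {s t : ZMod n} :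
    rot x s < rot x t ↔ ∃ r : ℕ, (∀ k < r, x (s + k) = x (t + k)) ∧ x (s + r) < x (t + r) :=
  Iff.rfl

theorem window_lt_iff {m : ℕ} {x : ZMod n → A} {s t : ZMod n} :
    window m x s < window m x t ↔
      ∃ r : Fin m, (∀ k < r, x (s + (k : ℕ)) = x (t + (k : ℕ))) ∧
        x (s + (r : ℕ)) < x (t + (r : ℕ)) :=
  Iff.rfl

theorem window_eq_iff {m : ℕ} {x : ZMod n → A} {s t : ZMod n} :
    window m x s = window m x t ↔ ∀ k < m, x (s + (k : ℕ)) = x (t + (k : ℕ)) := by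
  constructor
  · intro h k hk
    exact congrFun (toLex.injective h) ⟨k, hk⟩
  · intro h
    exact congrArg toLex (funext fun k : Fin m => h k k.2)

theorem rot_lt_of_window_lt {m : ℕ} {x : ZMod n → A} {s t : ZMod n}
    (h : window m x s < window m x t) : rot x s < rot x t := by
  obtain ⟨r, h1, h2⟩ := window_lt_iff.1 h
  exact rot_lt_iff.2 ⟨r, fun k hk => h1 ⟨k, hk.trans r.2⟩ hk, h2⟩

/-- Without repeated windows, comparing rotations is a local matter; this is what allows blocks to
be moved around later. -/
theorem window_lt_of_rot_lt {m : ℕ} {x : ZMod n → A} (hx : Function.Injective (window m x))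
    {s t : ZMod n} (h : rot x s < rot x t) : window m x s < window m x t := by
  rcases lt_trichotomy (window m x s) (window m x t) with h1 | h1 | h1
  · exact h1
  · rw [hx h1] at h
    exact absurd h (lt_irrefl _)
  · exact absurd (rot_lt_of_window_lt h1) h.asymm

theorem rot_injective_of_window_injective {m : ℕ} {x : ZMod n → A}
    (hx : Function.Injective (window m x)) : Function.Injective (rot x) := by
  intro s t h
  refine hx (window_eq_iff.2 fun k _ => ?_)
  exact congrFun (toLex.injective h) k

theorem rot_lt_of_rot_add_one_lt {x : ZMod n → A} {s t : ZMod n} (hst : x s = x t)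
    (h : rot x (s + 1) < rot x (t + 1)) : rot x s < rot x t := by
  obtain ⟨r, h1, h2⟩ := rot_lt_iff.1 h
  refine rot_lt_iff.2 ⟨r + 1, fun k hk => ?_, ?_⟩
  · cases k with
    | zero => simpa using hst
    | succ k =>
      have := h1 k (by omega)
      push_cast
      rwa [add_comm (k : ZMod n) 1, ← add_assoc, ← add_assoc]
  · push_cast
    rwa [add_comm (r : ZMod n) 1, ← add_assoc, ← add_assoc]

theorem rot_comp_add (x : ZMod n → A) (s t : ZMod n) :
    rot (x ∘ (· + s)) t = rot x (t + s) := by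
  refine congrArg toLex (funext fun k => ?_)
  simp only [Function.comp_apply]
  congr 1; ring

variable [NeZero n]

theorem toWord_rotate (x : ZMod n → A) (k : ℕ) :
    (toWord x).rotate k = toWord (x ∘ (· + (k : ZMod n))) := by
  refine List.ext_getElem (by simp) fun j h1 h2 => ?_
  rw [List.getElem_rotate]
  simp [toWord]

theorem toWord_comp_add_lt_iff {x : ZMod n → A} {s t : ZMod n} :
    toWord (x ∘ (· + s)) < toWord (x ∘ (· + t)) ↔ rot x s < rot x t := by
  rw [List.lt_iff_exists, rot_lt_iff]
  constructor
  · rintro (⟨-, h⟩ | ⟨r, h1, h2, h3, h4⟩)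
    · simp at h
    · refine ⟨r, fun k hk => ?_, ?_⟩
      · have := h3 k hk
        simpa [toWord, add_comm] using this
      · simpa [toWord, add_comm] using h4
  · rintro ⟨r, h1, h2⟩
    -- By periodicity, a first difference at `r ≥ n` would already occur at `r - n`.
    have hr : r < n := by
      by_contra hcon
      have h3 := h1 (r - n) (by have := NeZero.pos n; omega)
      have h4 : ((r - n : ℕ) : ZMod n) = r := by
        rw [Nat.cast_sub (by omega)]; simp
      rw [h4] at h3
      exact h2.ne h3
    refine Or.inr ⟨r, by simpa using hr, by simpa using hr, fun k hk => ?_, ?_⟩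
    · simpa [toWord, add_comm] using h1 k hk
    · simpa [toWord, add_comm] using h2

theorem toWord_comp_add_le_iff {x : ZMod n → A} {s t : ZMod n} :
    toWord (x ∘ (· + s)) ≤ toWord (x ∘ (· + t)) ↔ rot x s ≤ rot x t := by
  rw [← not_lt, ← not_lt]
  exact not_congr toWord_comp_add_lt_iff

theorem toWord_comp_add_eq_iff {x : ZMod n → A} {s t : ZMod n} :
    toWord (x ∘ (· + s)) = toWord (x ∘ (· + t)) ↔ rot x s = rot x t := by
  rw [le_antisymm_iff, le_antisymm_iff, toWord_comp_add_le_iff, toWord_comp_add_le_iff]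

theorem toWord_eq_comp_zero (x : ZMod n → A) : toWord x = toWord (x ∘ (· + 0)) := by
  congr 1; funext t; simp

theorem toWord_ne_nil (x : ZMod n → A) : toWord x ≠ [] := by
  intro h
  have := congrArg List.length h
  simp [NeZero.ne n] at this

theorem isLyndon_toWord_iff {x : ZMod n → A} :
    IsLyndon (toWord x) ↔ Function.Injective (rot x) ∧ ∀ s, rot x 0 ≤ rot x s := by
  have hle : ∀ k : ℕ, toWord x ≤ (toWord x).rotate k ↔ rot x 0 ≤ rot x k := by
    intro k
    rw [toWord_rotate, ← toWord_comp_add_le_iff, ← toWord_eq_comp_zero]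
  unfold IsLyndon
  rw [isPrimitive_iff_injOn (toWord_ne_nil x)]
  refine and_congr ?_ ?_
  · constructor
    · intro h s t hst
      rw [← toWord_comp_add_eq_iff] at hst
      have := h (x₁ := s.val) (x₂ := t.val) (by simpa using ZMod.val_lt s)
        (by simpa using ZMod.val_lt t)
        (by rw [toWord_rotate, toWord_rotate]; simpa using hst)
      exact ZMod.val_injective n this
    · intro h k hk l hl hkl
      simp only [length_toWord, Finset.coe_range, Set.mem_Iio] at hk hl
      rw [toWord_rotate, toWord_rotate, toWord_comp_add_eq_iff] at hkl
      have := congrArg ZMod.val (h hkl)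
      rwa [ZMod.val_cast_of_lt hk, ZMod.val_cast_of_lt hl] at this
  · constructor
    · intro h s
      have := (hle s.val).1 (h.2 (mem_necklace_rotate _ _))
      simpa using this
    · intro h
      refine ⟨List.IsRotated.refl _, ?_⟩
      rw [necklace_eq_image _ (toWord_ne_nil x)]
      rintro v ⟨k, -, rfl⟩
      exact (hle k).2 (h k)

/-- The rotation of the circular word `x` at `i` is the smallest one, and the rotation at `j` is
the second smallest one. -/
def IsLowestPair (x : ZMod n → A) (i j : ZMod n) : Prop :=
  Function.Injective (rot x) ∧ rot x i < rot x j ∧ ∀ t, t ≠ i → rot x j ≤ rot x t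

theorem IsLowestPair.rot_le {x : ZMod n → A} {i j : ZMod n} (h : IsLowestPair x i j)
    (t : ZMod n) : rot x i ≤ rot x t := by
  by_cases ht : t = i
  · rw [ht]
  · exact h.2.1.le.trans (h.2.2 t ht)

theorem IsLowestPair.ne {x : ZMod n → A} {i j : ZMod n} (h : IsLowestPair x i j) : i ≠ j := by
  rintro rfl
  exact lt_irrefl _ h.2.1

theorem IsLowestPair.unique {x : ZMod n → A} {i j i' j' : ZMod n} (h : IsLowestPair x i j)
    (h' : IsLowestPair x i' j') : i = i' ∧ j = j' := by
  have hi : i = i' := h.1 (le_antisymm (h.rot_le i') (h'.rot_le i))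
  subst hi
  exact ⟨rfl, h.1 (le_antisymm (h.2.2 j' h'.ne.symm) (h'.2.2 j h.ne.symm))⟩

theorem exists_isLowestPair {x : ZMod n → A} (hn : 2 ≤ n) (hx : Function.Injective (rot x)) :
    ∃ i j, IsLowestPair x i j := by
  classical
  obtain ⟨i, -, hi⟩ := Finset.exists_min_image Finset.univ (rot x) ⟨0, Finset.mem_univ _⟩
  have hne : (Finset.univ.erase i).Nonempty := by
    rw [← Finset.card_pos, Finset.card_erase_of_mem (Finset.mem_univ _), Finset.card_univ,
      ZMod.card]
    omega
  obtain ⟨j, hj, hj'⟩ := Finset.exists_min_image _ (rot x) hne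
  have hji : j ≠ i := (Finset.mem_erase.1 hj).1
  exact ⟨i, j, hx, lt_of_le_of_ne (hi j (Finset.mem_univ _)) fun h => hji (hx h).symm,
    fun t ht => hj' t (Finset.mem_erase.2 ⟨ht, Finset.mem_univ _⟩)⟩

theorem isLowestPair_comp_add_iff {x : ZMod n → A} {i j s : ZMod n} :
    IsLowestPair (x ∘ (· + s)) i j ↔ IsLowestPair x (i + s) (j + s) := by
  have h0 : rot (x ∘ (· + s)) = rot x ∘ (· + s) := funext fun t => rot_comp_add x s t
  unfold IsLowestPair
  rw [h0]
  refine and_congr ?_ (and_congr Iff.rfl ?_)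
  · exact ((Equiv.addRight s).injective_comp (rot x))
  · constructor
    · intro h t ht
      have := h (t - s) (fun h => ht (by rw [← h]; ring))
      simpa using this
    · intro h t ht
      exact h (t + s) (fun h => ht (add_right_cancel h))

theorem IsLowestPair.isLyndon {x : ZMod n → A} {j : ZMod n} (h : IsLowestPair x 0 j) :
    IsLyndon (toWord x) :=
  isLyndon_toWord_iff.2 ⟨h.1, h.rot_le⟩

theorem exists_isLowestPair_of_isLyndon {x : ZMod n → A} (hn : 2 ≤ n) (h : IsLyndon (toWord x)) :
    ∃ j, IsLowestPair x 0 j := by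
  rw [isLyndon_toWord_iff] at h
  obtain ⟨i, j, hij⟩ := exists_isLowestPair hn h.1
  have : i = 0 := h.1 (le_antisymm (hij.rot_le 0) (h.2 i))
  exact ⟨j, this ▸ hij⟩

/-- The factor starts at the second smallest rotation and runs to the end of the word, that is,
cyclically from `j` back to `0`. -/
theorem IsLowestPair.length_standardRightFactor {x : ZMod n → A} {j : ZMod n}
    (h : IsLowestPair x 0 j) : (standardRightFactor (toWord x)).length = (0 - j).val := by
  have hj : j ≠ 0 := h.ne.symm
  have : NeZero j := ⟨hj⟩
  have hs : standardRightFactor (toWord x) = (toWord x).drop j.val := by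
    refine h.isLyndon.standardRightFactor_eq (ZMod.val_pos.2 hj)
      (by simpa using ZMod.val_lt j) fun t ht htn => ?_
    rw [length_toWord] at htn
    rw [toWord_rotate, toWord_rotate, toWord_comp_add_le_iff, ZMod.natCast_zmod_val]
    refine h.2.2 _ fun h0 => ?_
    have := congrArg ZMod.val h0
    rw [ZMod.val_cast_of_lt htn, ZMod.val_zero] at this
    omega
  rw [hs, zero_sub, ZMod.val_neg_of_ne_zero]
  simp

variable (p : PMF A)

/-- A family of disjoint events indexed by a position, and compatible with the rotations. -/
theorem card_mul_measureReal_eq {S : ZMod n → Set (ZMod n → A)}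
    (hS : ∀ x s i, x ∘ (· + s) ∈ S i ↔ x ∈ S (i + s))
    (hd : ∀ x i j, x ∈ S i → x ∈ S j → i = j) (i : ZMod n) :
    n * (circularMeasure n p).real (S i) = (circularMeasure n p).real {x | ∃ j, x ∈ S j} := by
  have h1 : ∀ j, (circularMeasure n p).real (S j) = (circularMeasure n p).real (S i) := by
    intro j
    have h2 := circularMeasure_preimage_perm p (Equiv.addRight (j - i)) (S i)
    have h3 : {x : ZMod n → A | x ∘ (Equiv.addRight (j - i)) ∈ S i} = S j := by
      ext x
      have := hS x (j - i) i
      rw [add_sub_cancel] at this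
      exact this
    rw [h3] at h2
    rw [measureReal_def, h2, measureReal_def]
  have h2 : {x | ∃ j, x ∈ S j} = ⋃ j ∈ Finset.univ, S j := by ext x; simp
  rw [h2, measureReal_biUnion_finset]
  · simp [h1, ZMod.card]
  · intro j _ k _ hjk
    exact Set.disjoint_left.2 fun x hj hk => hjk (hd x j k hj hk)
  · intro _ _
    exact MeasurableSpace.measurableSet_top

theorem card_mul_measureReal_isLowestPair (Q : ℕ → Prop) :
    n * (circularMeasure n p).real {x | ∃ j, IsLowestPair x 0 j ∧ Q (0 - j).val} =
      (circularMeasure n p).real {x | ∃ i j, IsLowestPair x i j ∧ Q (i - j).val} := by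
  refine card_mul_measureReal_eq p
    (S := fun i => {x | ∃ j, IsLowestPair x i j ∧ Q (i - j).val}) ?_ ?_ 0
  · intro x s i
    simp only [Set.mem_ofPred_eq, isLowestPair_comp_add_iff]
    constructor
    · rintro ⟨j, h1, h2⟩
      exact ⟨j + s, h1, by rwa [add_sub_add_right_eq_sub]⟩
    · rintro ⟨j, h1, h2⟩
      refine ⟨j - s, by rwa [sub_add_cancel], ?_⟩
      rwa [show i - (j - s) = i + s - j by ring]
  · rintro x i j ⟨k, h1, -⟩ ⟨l, h2, -⟩
    exact (h1.unique h2).1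

/-- The `n` events obtained by varying `i` are disjoint and equally likely. -/
theorem measureReal_fst_isLowestPair_le (i : ZMod n) :
    (circularMeasure n p).real {x | ∃ j, IsLowestPair x i j} ≤ 1 / n := by
  have hn : (0 : ℝ) < n := by exact_mod_cast NeZero.pos n
  have h := card_mul_measureReal_eq p (S := fun i => {x | ∃ j, IsLowestPair x i j}) ?_ ?_ i
  · rw [le_div_iff₀ hn, mul_comm, h]
    exact measureReal_le_one
  · intro x s i
    simp only [Set.mem_ofPred_eq, isLowestPair_comp_add_iff]
    exact ((Equiv.addRight s).exists_congr_left (p := fun j => IsLowestPair x (i + s) (j + s))).trans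
      (by simp)
  · rintro x i j ⟨k, h1⟩ ⟨l, h2⟩
    exact (h1.unique h2).1

theorem measureReal_snd_isLowestPair_le (j : ZMod n) :
    (circularMeasure n p).real {x | ∃ i, IsLowestPair x i j} ≤ 1 / n := by
  have hn : (0 : ℝ) < n := by exact_mod_cast NeZero.pos n
  have h := card_mul_measureReal_eq p (S := fun j => {x | ∃ i, IsLowestPair x i j}) ?_ ?_ j
  · rw [le_div_iff₀ hn, mul_comm, h]
    exact measureReal_le_one
  · intro x s j
    simp only [Set.mem_ofPred_eq, isLowestPair_comp_add_iff]
    exact ((Equiv.addRight s).exists_congr_left (p := fun i => IsLowestPair x (i + s) (j + s))).trans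
      (by simp)
  · rintro x i j ⟨k, h1⟩ ⟨l, h2⟩
    exact (h1.unique h2).2

end Rotations

/-! ### Repeated windows and runs of the smallest letter -/

section Runs

set_option linter.unusedSectionVars false

variable {A : Type*} [LinearOrder A] {n : ℕ} [NeZero n] {p : PMF A}

theorem natCast_inj_of_lt {k l : ℕ} (hk : k < n) (hl : l < n) (h : (k : ZMod n) = l) : k = l := by
  have := congrArg ZMod.val h
  rwa [ZMod.val_cast_of_lt hk, ZMod.val_cast_of_lt hl] at this

/-- Reveal the second window letter by letter: each new letter must match one at another position,
at a cost of at most `ρ`. Overlapping windows are allowed. -/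
theorem measure_window_eq_le {ρ : ℝ≥0∞} (hρ : ∀ a, p a ≤ ρ) {s t : ZMod n} (hst : s ≠ t) {m : ℕ}
    (hm : (t - s).val + m ≤ n) :
    circularMeasure n p {x | window m x s = window m x t} ≤ ρ ^ m := by
  simp only [window_eq_iff]
  induction m with
  | zero => simp
  | succ m ih =>
    have hd : 0 < (t - s).val := by
      have : NeZero (t - s) := ⟨sub_ne_zero.2 hst.symm⟩
      exact ZMod.val_pos.2 (sub_ne_zero.2 hst.symm)
    have hds : t = s + ((t - s).val : ZMod n) := by
      rw [ZMod.natCast_zmod_val]; ring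
    -- The position `t + m` is new: the arc from `s` to it is too short to wrap around the circle.
    have h1 : ∀ k ≤ m, s + (k : ZMod n) ≠ t + (m : ZMod n) := by
      intro k hk h
      rw [hds, add_assoc, add_right_inj, ← Nat.cast_add] at h
      have := natCast_inj_of_lt (by omega) (by omega) h
      omega
    have h2 : ∀ k < m, t + (k : ZMod n) ≠ t + (m : ZMod n) := by
      intro k hk h
      rw [add_right_inj] at h
      have := natCast_inj_of_lt (by omega) (by omega) h
      omega
    have h3 : {x : ZMod n → A | ∀ k < m + 1, x (s + (k : ℕ)) = x (t + (k : ℕ))} =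
        {x | ∀ k < m, x (s + (k : ℕ)) = x (t + (k : ℕ))} ∩
          {x | x (t + (m : ℕ)) = x (s + (m : ℕ))} := by
      ext x
      simp only [Set.mem_ofPred_eq, Set.mem_inter_iff, Nat.lt_succ_iff_lt_or_eq]
      constructor
      · intro h
        exact ⟨fun k hk => h k (Or.inl hk), (h m (Or.inr rfl)).symm⟩
      · rintro ⟨h, h'⟩ k (hk | rfl)
        · exact h k hk
        · exact h'.symm
    rw [h3, pow_succ']
    refine (circularMeasure_inter_le ?_ (φ := fun x : ZMod n → A => x (s + (m : ZMod n))) ?_ hρ).trans ?_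
    · intro x b
      simp only [Set.mem_ofPred_eq]
      refine forall₂_congr fun k hk => ?_
      rw [Function.update_of_ne (h1 k hk.le), Function.update_of_ne (h2 k hk)]
    · intro x b
      rw [Function.update_of_ne (h1 m le_rfl)]
    · gcongr
      exact ih (by omega)

theorem measureReal_not_injective_window_le {ρ : ℝ} (hρ0 : 0 ≤ ρ) (hρ : ∀ a, (p a).toReal ≤ ρ)
    {m : ℕ} (hm : 2 * m ≤ n) :
    (circularMeasure n p).real {x | ¬ Function.Injective (window m x)} ≤ n ^ 2 * ρ ^ m := by
  classical
  have hρ' : ∀ a, p a ≤ ENNReal.ofReal ρ := fun a =>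
    (ENNReal.le_ofReal_iff_toReal_le (p.apply_ne_top a) hρ0).2 (hρ a)
  let J : Finset (ZMod n × ZMod n) :=
    Finset.univ.filter fun q => q.1 ≠ q.2 ∧ (q.2 - q.1).val + m ≤ n
  have hsub : {x : ZMod n → A | ¬ Function.Injective (window m x)} ⊆
      ⋃ q ∈ J, {x | window m x q.1 = window m x q.2} := by
    intro x hx
    simp only [Function.Injective, Set.mem_ofPred_eq, not_forall] at hx
    obtain ⟨s, t, h1, h2⟩ := hx
    simp only [Set.mem_iUnion]
    by_cases hst : (t - s).val + m ≤ n
    · exact ⟨(s, t), by simp [J, h2, hst], h1⟩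
    -- The two cyclic distances add up to `n`, and `2 * m ≤ n`, so one of the two orders of the pair
    -- satisfies the arc condition.
    · refine ⟨(t, s), ?_, h1.symm⟩
      have : NeZero (t - s) := ⟨sub_ne_zero.2 (Ne.symm h2)⟩
      have h3 : (s - t).val = n - (t - s).val := by
        rw [← neg_sub, ZMod.val_neg_of_ne_zero]
      simp only [J, Finset.mem_filter, Finset.mem_univ, true_and]
      exact ⟨Ne.symm h2, by omega⟩
  calc (circularMeasure n p).real {x | ¬ Function.Injective (window m x)}
      ≤ ∑ q ∈ J, (circularMeasure n p).real {x | window m x q.1 = window m x q.2} :=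
        (measureReal_mono hsub (measure_ne_top _ _)).trans (measureReal_biUnion_finset_le _ _)
    _ ≤ ∑ q ∈ J, ρ ^ m := by
        refine Finset.sum_le_sum fun q hq => ?_
        simp only [J, Finset.mem_filter, Finset.mem_univ, true_and] at hq
        have := measure_window_eq_le hρ' hq.1 hq.2
        rw [← ENNReal.ofReal_pow hρ0] at this
        exact ENNReal.toReal_le_of_le_ofReal (by positivity) this
    _ ≤ n ^ 2 * ρ ^ m := by
        rw [Finset.sum_const, nsmul_eq_mul]
        gcongr
        have : J.card ≤ n * n := by
          refine (Finset.card_le_univ _).trans ?_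
          simp [ZMod.card]
        rw [sq]
        exact_mod_cast this

theorem measureReal_forall_eq (U : Finset (ZMod n)) (a : A) :
    (circularMeasure n p).real {x | ∀ u ∈ U, x u = a} = (p a).toReal ^ U.card := by
  rw [measureReal_def, circularMeasure_cylinder, ENNReal.toReal_pow]

theorem card_image_arc (s : ZMod n) {h : ℕ} (hh : h ≤ n) :
    ((Finset.range h).image fun k : ℕ => s + (k : ZMod n)).card = h := by
  rw [Finset.card_image_of_injOn, Finset.card_range]
  intro k hk l hl hkl
  simp only [Finset.coe_range, Set.mem_Iio] at hk hl
  exact natCast_inj_of_lt (by omega) (by omega) (add_left_cancel hkl)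

/-- The `M` arcs of length `h` are disjoint, so the events that they are runs of `a` are
independent. -/
theorem measureReal_forall_not_run (a : A) {h M : ℕ} (hM : M * h ≤ n) :
    (circularMeasure n p).real
      {x | ∀ q < M, ¬ ∀ k < h, x (((q * h + k : ℕ) : ZMod n)) = a} =
        (1 - (p a).toReal ^ h) ^ M := by
  classical
  induction M with
  | zero => simp
  | succ M ih =>
    set S : Set (ZMod n → A) := {x | ∀ q < M, ¬ ∀ k < h, x (((q * h + k : ℕ) : ZMod n)) = a}
      with hS
    have hMh : M * h + h ≤ n := by rw [← Nat.succ_mul]; exact hM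
    let U : Finset (ZMod n) := (Finset.range h).image fun k : ℕ => ((M * h : ℕ) : ZMod n) + k
    have hins : ∀ c ∈ U, InsensitiveAt S c := by
      intro c hc x b
      obtain ⟨k, hk, rfl⟩ := Finset.mem_image.1 hc
      rw [Finset.mem_range] at hk
      simp only [hS, Set.mem_ofPred_eq]
      refine forall₂_congr fun q hq => not_congr (forall₂_congr fun l hl => ?_)
      rw [Function.update_of_ne]
      intro heq
      rw [← Nat.cast_add] at heq
      have h1 : q * h + h ≤ M * h := by
        rw [← Nat.succ_mul]; exact Nat.mul_le_mul_right h hq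
      have := natCast_inj_of_lt (by omega) (by omega) heq
      omega
    have hset : {x : ZMod n → A | ∀ q < M + 1, ¬ ∀ k < h, x (((q * h + k : ℕ) : ZMod n)) = a} =
        S \ (S ∩ {x | ∀ u ∈ U, x u = a}) := by
      ext x
      simp only [Nat.lt_succ_iff_lt_or_eq, Set.mem_ofPred_eq, Set.mem_sdiff, Set.mem_inter_iff, U,
        Finset.mem_image, Finset.mem_range, forall_exists_index, and_imp,
        forall_apply_eq_imp_iff₂, hS, not_and, ← Nat.cast_add]
      constructor
      · intro H
        exact ⟨fun q hq => H q (Or.inl hq), fun _ => H M (Or.inr rfl)⟩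
      · rintro ⟨H1, H2⟩ q (hq | rfl)
        · exact H1 q hq
        · exact H2 H1
    rw [hset, measureReal_sdiff Set.inter_subset_left MeasurableSpace.measurableSet_top,
      ih (by omega)]
    have hcyl := circularMeasure_inter_cylinder (p := p) U hins a
    rw [card_image_arc _ (by omega)] at hcyl
    rw [measureReal_def (s := S ∩ _), hcyl, ENNReal.toReal_mul, ENNReal.toReal_pow,
      ← measureReal_def, ih (by omega)]
    ring

/-! ### Position of the second smallest rotation with respect to runs of the smallest letter -/

variable {a : A}

/-- The smallest rotation starts at the beginning of a run: prepending the same letter to `rot x i <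
rot x (i + 1)` would otherwise make the rotation at `i - 1` smaller. -/
theorem IsLowestPair.apply_sub_one_ne {x : ZMod n → A} {i j : ZMod n} (h : IsLowestPair x i j)
    (hi : x i = a) : x (i - 1) ≠ a := by
  intro h1
  have h2 : rot x i < rot x (i + 1) := by
    refine lt_of_le_of_ne (h.rot_le _) fun heq => ?_
    have h3 := h.1 heq
    have h4 : (1 : ZMod n) = 0 := by
      rw [left_eq_add] at h3; exact h3
    exact h.ne (by rw [← mul_one i, ← mul_one j, h4, mul_zero, mul_zero])
  have h3 : rot x (i - 1) < rot x i := by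
    refine rot_lt_of_rot_add_one_lt (by rw [h1, hi]) ?_
    rwa [sub_add_cancel]
  exact absurd (h.rot_le (i - 1)) (not_le.2 h3)

/-- The same argument applies to `j`, except that `j - 1` could be `i`, which `hij` rules out. The
case `j + 1 = i` is excluded because `i` begins a run. -/
theorem IsLowestPair.apply_snd_sub_one_ne {x : ZMod n → A} {i j : ZMod n}
    (h : IsLowestPair x i j) (hi : x i = a) (hj : x j = a) (hij : j ≠ i + 1) : x (j - 1) ≠ a := by
  intro h1
  have hne : j + 1 ≠ i := by
    rintro rfl
    exact h.apply_sub_one_ne hi (by rwa [add_sub_cancel_right])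
  have h2 : rot x j < rot x (j + 1) := by
    refine lt_of_le_of_ne (h.2.2 _ hne) fun heq => ?_
    have h3 := h.1 heq
    have h4 : (1 : ZMod n) = 0 := by
      rw [left_eq_add] at h3; exact h3
    exact h.ne (by rw [← mul_one i, ← mul_one j, h4, mul_zero, mul_zero])
  have h3 : rot x (j - 1) < rot x j := by
    refine rot_lt_of_rot_add_one_lt (by rw [h1, hj]) ?_
    rwa [sub_add_cancel]
  refine absurd (h.2.2 (j - 1) fun h4 => hij ?_) (not_le.2 h3)
  rw [← h4, sub_add_cancel]

/-- At its first letter other than `a`, the rotation at `s` would exceed the one at `t`. -/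
theorem apply_eq_of_rot_le (ha : ∀ b, a ≤ b) {x : ZMod n → A} {s t : ZMod n} {h : ℕ}
    (ht : ∀ k < h, x (t + (k : ℕ)) = a) (hst : rot x s ≤ rot x t) :
    ∀ k < h, x (s + (k : ℕ)) = a := by
  intro k
  induction k using Nat.strong_induction_on with
  | _ k ih =>
    intro hk
    refine le_antisymm ?_ (ha _)
    rw [← ht k hk]
    by_contra hcon
    refine absurd hst (not_le.2 (rot_lt_iff.2 ⟨k, fun l hl => ?_, not_le.1 hcon⟩))
    rw [ht l (hl.trans hk), ih l hl (hl.trans hk)]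

/-- If the smallest letter has a run of length `h + 1`, then the runs of length `h + 1` and `h`
starting at the two smallest rotations do not overlap, unless these rotations are consecutive. -/
theorem IsLowestPair.exists_runs (ha : ∀ b, a ≤ b) {x : ZMod n → A} {i j : ZMod n}
    (hp : IsLowestPair x i j) (hij : j ≠ i + 1) {h : ℕ} (hh : 0 < h) {t : ZMod n}
    (ht : ∀ k < h + 1, x (t + (k : ℕ)) = a) :
    (∀ k < h + 1, x (i + (k : ℕ)) = a) ∧ (∀ k < h, x (j + (k : ℕ)) = a) ∧
      ∀ k < h + 1, ∀ l < h, i + (k : ZMod n) ≠ j + (l : ZMod n) := by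
  have hi := apply_eq_of_rot_le ha ht (hp.rot_le t)
  have hi1 : i + 1 ≠ i := by
    intro h3
    have h4 : (1 : ZMod n) = 0 := by rw [add_eq_left] at h3; exact h3
    exact hp.ne (by rw [← mul_one i, ← mul_one j, h4, mul_zero, mul_zero])
  have hj : ∀ k < h, x (j + (k : ℕ)) = a := by
    -- The rotation at `i + 1` competes for second place and keeps all but the first letter of the
    -- run at `i`: hence `h` instead of `h + 1`.
    refine apply_eq_of_rot_le ha (t := i + 1) (fun k hk => ?_) (hp.2.2 _ hi1)
    have := hi (k + 1) (by omega)
    push_cast at this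
    rwa [add_assoc, add_comm (1 : ZMod n)]
  have hi0 : x i = a := by simpa using hi 0 (by omega)
  have hj0 : x j = a := by simpa using hj 0 hh
  refine ⟨hi, hj, fun k hk l hl heq => ?_⟩
  -- If the runs met, the one starting inside the other would be preceded by the letter `a`,
  -- contrary to the two preceding lemmas.
  rcases lt_trichotomy k l with hkl | rfl | hkl
  · refine hp.apply_sub_one_ne hi0 ?_
    have := hj (l - k - 1) (by omega)
    rw [Nat.cast_sub (by omega), Nat.cast_sub (by omega), Nat.cast_one] at this
    rw [← this]; congr 1
    linear_combination heq
  · exact hp.ne (add_right_cancel heq)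
  · refine hp.apply_snd_sub_one_ne hi0 hj0 hij ?_
    have := hi (k - l - 1) (by omega)
    rw [Nat.cast_sub (by omega), Nat.cast_sub (by omega), Nat.cast_one] at this
    rw [← this]; congr 1
    linear_combination -heq

theorem measureReal_runs_le {i j : ZMod n} {h : ℕ} (hh : h + 1 ≤ n) :
    (circularMeasure n p).real {x | (∀ k < h + 1, x (i + (k : ℕ)) = a) ∧
      (∀ k < h, x (j + (k : ℕ)) = a) ∧
        ∀ k < h + 1, ∀ l < h, i + (k : ZMod n) ≠ j + (l : ZMod n)} ≤
      (p a).toReal ^ (2 * h + 1) := by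
  classical
  by_cases hd : ∀ k < h + 1, ∀ l < h, i + (k : ZMod n) ≠ j + (l : ZMod n)
  · let U := (Finset.range (h + 1)).image fun k : ℕ => i + (k : ZMod n)
    let V := (Finset.range h).image fun k : ℕ => j + (k : ZMod n)
    have hUV : Disjoint U V := by
      rw [Finset.disjoint_left]
      intro u hu hv
      obtain ⟨k, hk, rfl⟩ := Finset.mem_image.1 hu
      obtain ⟨l, hl, hkl⟩ := Finset.mem_image.1 hv
      exact hd k (Finset.mem_range.1 hk) l (Finset.mem_range.1 hl) hkl.symm
    have hcard : (U ∪ V).card = 2 * h + 1 := by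
      rw [Finset.card_union_of_disjoint hUV, card_image_arc _ hh, card_image_arc _ (by omega)]
      omega
    rw [← hcard, ← measureReal_forall_eq]
    refine measureReal_mono fun x hx u hu => ?_
    rcases Finset.mem_union.1 hu with hu | hu
    · obtain ⟨k, hk, rfl⟩ := Finset.mem_image.1 hu
      exact hx.1 k (Finset.mem_range.1 hk)
    · obtain ⟨k, hk, rfl⟩ := Finset.mem_image.1 hu
      exact hx.2.1 k (Finset.mem_range.1 hk)
  · have : {x : ZMod n → A | (∀ k < h + 1, x (i + (k : ℕ)) = a) ∧
        (∀ k < h, x (j + (k : ℕ)) = a) ∧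
        ∀ k < h + 1, ∀ l < h, i + (k : ZMod n) ≠ j + (l : ZMod n)} = ∅ := by
      ext x
      simp only [Set.mem_ofPred_eq, Set.mem_empty_iff_false, iff_false, not_and]
      exact fun _ _ => hd
    rw [this]
    simp

/-- The two smallest rotations are unlikely to be at non consecutive positions `i`, `j` such that
`(i, j)` belongs to a small set. -/
theorem measureReal_isLowestPair_mem_le (ha : ∀ b, a ≤ b) (J : Finset (ZMod n × ZMod n))
    {h M : ℕ} (hh : 0 < h) (hM : 0 < M) (hMn : M * (h + 1) ≤ n) :
    (circularMeasure n p).real {x | ∃ i j, IsLowestPair x i j ∧ j ≠ i + 1 ∧ (i, j) ∈ J} ≤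
      (1 - (p a).toReal ^ (h + 1)) ^ M + J.card * (p a).toReal ^ (2 * h + 1) := by
  have hhn : h + 1 ≤ n := le_trans (Nat.le_mul_of_pos_left _ hM) hMn
  let S : ZMod n × ZMod n → Set (ZMod n → A) := fun q =>
    {x | (∀ k < h + 1, x (q.1 + (k : ℕ)) = a) ∧ (∀ k < h, x (q.2 + (k : ℕ)) = a) ∧
        ∀ k < h + 1, ∀ l < h, q.1 + (k : ZMod n) ≠ q.2 + (l : ZMod n)}
  have hsub : {x : ZMod n → A | ∃ i j, IsLowestPair x i j ∧ j ≠ i + 1 ∧ (i, j) ∈ J} ⊆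
      {x | ∀ q < M, ¬ ∀ k < h + 1, x (((q * (h + 1) + k : ℕ) : ZMod n)) = a} ∪
        ⋃ q ∈ J, S q := by
    rintro x ⟨i, j, hp, hij, hJ⟩
    by_cases hx : ∀ q < M, ¬ ∀ k < h + 1, x (((q * (h + 1) + k : ℕ) : ZMod n)) = a
    · exact Or.inl hx
    · push Not at hx
      obtain ⟨q, -, hq⟩ := hx
      simp only [Set.mem_union, Set.mem_iUnion]
      refine Or.inr ⟨(i, j), hJ, ?_⟩
      refine hp.exists_runs ha hij hh (t := ((q * (h + 1) : ℕ) : ZMod n)) fun k hk => ?_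
      rw [← Nat.cast_add]
      exact hq k hk
  refine (measureReal_mono hsub (measure_ne_top _ _)).trans ((measureReal_union_le _ _).trans ?_)
  refine add_le_add (measureReal_forall_not_run a hMn).le ?_
  refine (measureReal_biUnion_finset_le _ _).trans ?_
  rw [← nsmul_eq_mul, ← Finset.sum_const]
  exact Finset.sum_le_sum fun q _ => measureReal_runs_le hhn

end Runs

/-! ### Blocks of letters -/

section Blocks

set_option linter.unusedSectionVars false

variable {A : Type*} [LinearOrder A] {n : ℕ} [NeZero n] {p : PMF A} {b m B : ℕ}

variable (n) in
/-- The positions of the windows of length `m` contained in the `c`-th block of length `b`. -/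
def interior (b m c : ℕ) : Finset (ZMod n) :=
  (Finset.Ico (c * b) (c * b + b + 1 - m)).image fun k : ℕ => (k : ZMod n)

theorem block_le {c : ℕ} (hB : B * b ≤ n) (hc : c < B) : c * b + b ≤ n := by
  rw [← Nat.succ_mul]
  exact (Nat.mul_le_mul_right b hc).trans hB

theorem block_disjoint (b : ℕ) {c d : ℕ} (h : c ≠ d) : c * b + b ≤ d * b ∨ d * b + b ≤ c * b := by
  rw [← Nat.succ_mul, ← Nat.succ_mul]
  rcases lt_or_gt_of_ne h with h | h
  · exact Or.inl (Nat.mul_le_mul_right b h)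
  · exact Or.inr (Nat.mul_le_mul_right b h)

theorem mem_interior_iff (hB : B * b ≤ n) (hm : 1 ≤ m) {c : ℕ} (hc : c < B) {t : ZMod n} :
    t ∈ interior n b m c ↔ c * b ≤ t.val ∧ t.val + m ≤ c * b + b := by
  have hcn := block_le hB hc
  simp only [interior, Finset.mem_image, Finset.mem_Ico]
  constructor
  · rintro ⟨k, hk, rfl⟩
    rw [ZMod.val_cast_of_lt (by omega)]
    omega
  · intro h
    exact ⟨t.val, by omega, ZMod.natCast_zmod_val t⟩

theorem card_interior (hB : B * b ≤ n) (hm : 1 ≤ m) {c : ℕ} (hc : c < B) :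
    (interior n b m c).card = b + 1 - m := by
  have hcn := block_le hB hc
  rw [interior, Finset.card_image_of_injOn, Nat.card_Ico]
  · omega
  · intro k hk l hl hkl
    simp only [Finset.coe_Ico, Set.mem_Ico] at hk hl
    exact natCast_inj_of_lt (by omega) (by omega) hkl

theorem eq_of_mem_interior (hB : B * b ≤ n) (hm : 1 ≤ m) {c d : ℕ} (hc : c < B) (hd : d < B)
    {t : ZMod n} (h1 : t ∈ interior n b m c) (h2 : t ∈ interior n b m d) : c = d := by
  rw [mem_interior_iff hB hm hc] at h1
  rw [mem_interior_iff hB hm hd] at h2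
  by_contra hcd
  have := block_disjoint b hcd
  omega

variable (n) in
/-- The positions of the windows of length `m` contained in one of the `B` first blocks of
length `b`. -/
def interiors (b m B : ℕ) : Finset (ZMod n) := (Finset.range B).biUnion (interior n b m)

theorem mem_interiors_iff {t : ZMod n} :
    t ∈ interiors n b m B ↔ ∃ c < B, t ∈ interior n b m c := by
  simp [interiors]

theorem card_interiors (hB : B * b ≤ n) (hm : 1 ≤ m) :
    (interiors n b m B).card = B * (b + 1 - m) := by
  rw [interiors, Finset.card_biUnion, Finset.sum_congr rfl fun c hc =>
    card_interior hB hm (Finset.mem_range.1 hc)]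
  · simp
  · intro c hc d hd hcd
    rw [Function.onFun, Finset.disjoint_left]
    exact fun t h1 h2 => hcd (eq_of_mem_interior hB hm (by simpa using hc) (by simpa using hd) h1 h2)

/-! ### Exchange of two blocks -/

/-- The involution of the integers that exchanges the `c`-th and the `d`-th block of length `b`. -/
def swapNat (b c d k : ℕ) : ℕ :=
  if c * b ≤ k ∧ k < c * b + b then k - c * b + d * b
  else if d * b ≤ k ∧ k < d * b + b then k - d * b + c * b else k

theorem swapNat_swapNat (b : ℕ) {c d : ℕ} (h : c ≠ d) (k : ℕ) :
    swapNat b c d (swapNat b c d k) = k := by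
  have := block_disjoint b h
  unfold swapNat
  split_ifs <;> omega

theorem swapNat_lt (hB : B * b ≤ n) {c d : ℕ} (hc : c < B) (hd : d < B) {k : ℕ} (hk : k < n) :
    swapNat b c d k < n := by
  have := block_le hB hc
  have := block_le hB hd
  unfold swapNat
  split_ifs <;> omega

theorem swapNat_of_mem (b : ℕ) (c d : ℕ) {e k : ℕ} (h1 : e * b ≤ k)
    (h2 : k < e * b + b) : swapNat b c d k = k - e * b + Equiv.swap c d e * b := by
  unfold swapNat
  by_cases hec : e = c
  · subst hec
    rw [if_pos ⟨h1, h2⟩, Equiv.swap_apply_left]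
  · have hc := block_disjoint b hec
    rw [if_neg (by omega)]
    by_cases hed : e = d
    · subst hed
      rw [if_pos ⟨h1, h2⟩, Equiv.swap_apply_right]
    · have hd := block_disjoint b hed
      rw [if_neg (by omega), Equiv.swap_apply_of_ne_of_ne hec hed]
      omega

/-- The permutation of the positions that exchanges the `c`-th and the `d`-th block of
length `b`. -/
def blockSwap (hB : B * b ≤ n) {c d : ℕ} (hc : c < B) (hd : d < B) (hcd : c ≠ d) :
    Equiv.Perm (ZMod n) :=
  Function.Involutive.toPerm (fun t : ZMod n => ((swapNat b c d t.val : ℕ) : ZMod n)) fun t => by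
    simp only
    rw [ZMod.val_cast_of_lt (swapNat_lt hB hc hd (ZMod.val_lt t)), swapNat_swapNat b hcd,
      ZMod.natCast_zmod_val]

theorem blockSwap_apply (hB : B * b ≤ n) {c d : ℕ} (hc : c < B) (hd : d < B) (hcd : c ≠ d)
    (t : ZMod n) : blockSwap hB hc hd hcd t = ((swapNat b c d t.val : ℕ) : ZMod n) := rfl

theorem blockSwap_blockSwap (hB : B * b ≤ n) {c d : ℕ} (hc : c < B) (hd : d < B) (hcd : c ≠ d)
    (t : ZMod n) : blockSwap hB hc hd hcd (blockSwap hB hc hd hcd t) = t :=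
  Function.Involutive.toPerm_involutive _ t

theorem val_blockSwap (hB : B * b ≤ n) {c d : ℕ} (hc : c < B) (hd : d < B) (hcd : c ≠ d)
    (t : ZMod n) : (blockSwap hB hc hd hcd t).val = swapNat b c d t.val := by
  rw [blockSwap_apply, ZMod.val_cast_of_lt (swapNat_lt hB hc hd (ZMod.val_lt t))]

theorem swap_lt {c d e : ℕ} (hc : c < B) (hd : d < B) (he : e < B) : Equiv.swap c d e < B := by
  rw [Equiv.swap_apply_def]
  split_ifs <;> assumption

theorem blockSwap_mem_interior (hB : B * b ≤ n) (hm : 1 ≤ m) {c d e : ℕ} (hc : c < B) (hd : d < B)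
    (hcd : c ≠ d) (he : e < B) {t : ZMod n} (ht : t ∈ interior n b m e) :
    blockSwap hB hc hd hcd t ∈ interior n b m (Equiv.swap c d e) := by
  rw [mem_interior_iff hB hm he] at ht
  rw [mem_interior_iff hB hm (swap_lt hc hd he), val_blockSwap,
    swapNat_of_mem b c d ht.1 (by omega)]
  omega

/-- A window contained in a block is transported rigidly. This fails for windows that cross a
boundary, hence the restriction to interiors. -/
theorem blockSwap_add (hB : B * b ≤ n) (hm : 1 ≤ m) {c d e : ℕ} (hc : c < B) (hd : d < B)
    (hcd : c ≠ d) (he : e < B) {t : ZMod n} (ht : t ∈ interior n b m e) {k : ℕ} (hk : k < m) :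
    blockSwap hB hc hd hcd (t + k) = blockSwap hB hc hd hcd t + k := by
  rw [mem_interior_iff hB hm he] at ht
  have hen := block_le hB he
  have h1 : (t + (k : ZMod n)).val = t.val + k := by
    conv_lhs => rw [← ZMod.natCast_zmod_val t, ← Nat.cast_add]
    exact ZMod.val_cast_of_lt (by omega)
  rw [blockSwap_apply, blockSwap_apply, h1, swapNat_of_mem b c d (e := e) (by omega) (by omega),
    swapNat_of_mem b c d ht.1 (by omega), ← Nat.cast_add]
  congr 1
  omega

/-- Among the windows contained in a block, the smallest one is in the `c`-th block and the second
smallest one is in the `e`-th block. -/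
def IsBlockPair (b m B : ℕ) (x : ZMod n → A) (c e : ℕ) : Prop :=
  ∃ i ∈ interior n b m c, ∃ j ∈ interior n b m e, window m x i < window m x j ∧
    ∀ t ∈ interiors n b m B, t ≠ i → t ≠ j → window m x j < window m x t

theorem IsBlockPair.unique (hB : B * b ≤ n) (hm : 1 ≤ m) {x : ZMod n → A} {c e c' e' : ℕ}
    (hc : c < B) (he : e < B) (hc' : c' < B) (he' : e' < B)
    (h : IsBlockPair b m B x c e) (h' : IsBlockPair b m B x c' e') : c = c' ∧ e = e' := by
  obtain ⟨i, hi, j, hj, hij, hmin⟩ := h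
  obtain ⟨i', hi', j', hj', hij', hmin'⟩ := h'
  have mi := mem_interiors_iff.2 ⟨c, hc, hi⟩
  have mj := mem_interiors_iff.2 ⟨e, he, hj⟩
  have mi' := mem_interiors_iff.2 ⟨c', hc', hi'⟩
  have mj' := mem_interiors_iff.2 ⟨e', he', hj'⟩
  have hle : ∀ t ∈ interiors n b m B, t ≠ i → window m x j ≤ window m x t := by
    intro t ht hti
    by_cases h : t = j
    · rw [h]
    · exact (hmin t ht hti h).le
  have hle' : ∀ t ∈ interiors n b m B, t ≠ i' → window m x j' ≤ window m x t := by
    intro t ht hti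
    by_cases h : t = j'
    · rw [h]
    · exact (hmin' t ht hti h).le
  have hii : i = i' := by
    by_contra hne
    have h1 := hle i' mi' (Ne.symm hne)
    have h2 := hle' i mi hne
    exact absurd ((hij.trans_le h1).trans (hij'.trans_le h2)) (lt_irrefl _)
  subst hii
  have hjj : j = j' := by
    by_contra hne
    have h1 : j ≠ i := fun h => hij.ne (by rw [h])
    have h2 : j' ≠ i := fun h => hij'.ne (by rw [h])
    exact absurd (hmin j' mj' h2 (Ne.symm hne)) (hmin' j mj h1 hne).asymm
  subst hjj
  exact ⟨eq_of_mem_interior hB hm hc hc' hi hi', eq_of_mem_interior hB hm he he' hj hj'⟩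

theorem IsBlockPair.comp_blockSwap (hB : B * b ≤ n) (hm : 1 ≤ m) {c d : ℕ} (hc : c < B)
    (hd : d < B) (hcd : c ≠ d) {x : ZMod n → A} {e f : ℕ} (he : e < B) (hf : f < B)
    (h : IsBlockPair b m B x e f) :
    IsBlockPair b m B (x ∘ blockSwap hB hc hd hcd) (Equiv.swap c d e) (Equiv.swap c d f) := by
  obtain ⟨i, hi, j, hj, hij, hmin⟩ := h
  set π := blockSwap hB hc hd hcd with hπ
  have hππ : ∀ t, π (π t) = t := blockSwap_blockSwap hB hc hd hcd
  have hw : ∀ g < B, ∀ t ∈ interior n b m g, window m (x ∘ π) t = window m x (π t) := by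
    intro g hg t ht
    refine congrArg toLex (funext fun k => ?_)
    rw [Function.comp_apply, blockSwap_add hB hm hc hd hcd hg ht k.2]
  have hi' := blockSwap_mem_interior hB hm hc hd hcd he hi
  have hj' := blockSwap_mem_interior hB hm hc hd hcd hf hj
  refine ⟨π i, hi', π j, hj', ?_, fun t ht hti htj => ?_⟩
  · rwa [hw _ (swap_lt hc hd he) _ hi', hw _ (swap_lt hc hd hf) _ hj', hππ, hππ]
  · obtain ⟨g, hg, htg⟩ := mem_interiors_iff.1 ht
    rw [hw _ (swap_lt hc hd hf) _ hj', hw g hg t htg, hππ]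
    refine hmin _ (mem_interiors_iff.2 ⟨_, swap_lt hc hd hg,
      blockSwap_mem_interior hB hm hc hd hcd hg htg⟩) ?_ ?_
    · rintro h; exact hti (by rw [← h, hππ])
    · rintro h; exact htj (by rw [← h, hππ])

theorem measureReal_isBlockPair_le (hB : B * b ≤ n) (hm : 1 ≤ m) {c d e f : ℕ} (hc : c < B)
    (hd : d < B) (hcd : c ≠ d) (he : e < B) (hf : f < B) :
    (circularMeasure n p).real {x | IsBlockPair b m B x e f} ≤
      (circularMeasure n p).real
        {x | IsBlockPair b m B x (Equiv.swap c d e) (Equiv.swap c d f)} := by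
  rw [measureReal_def, measureReal_def,
    ← circularMeasure_preimage_perm p (blockSwap hB hc hd hcd)
      {x | IsBlockPair b m B x (Equiv.swap c d e) (Equiv.swap c d f)}]
  exact ENNReal.toReal_mono (measure_ne_top _ _)
    (measure_mono fun x hx => IsBlockPair.comp_blockSwap hB hm hc hd hcd he hf hx)

/-- Exchanging `c` and `d` fixes `e`. Applied in both directions, this says that all blocks other
than `e` are equally likely to contain the smallest window when the second smallest is in `e`. -/
theorem measureReal_isBlockPair_fst_le (hB : B * b ≤ n) (hm : 1 ≤ m) {c d e : ℕ} (hc : c < B)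
    (hd : d < B) (he : e < B) (hce : c ≠ e) (hde : d ≠ e) :
    (circularMeasure n p).real {x | IsBlockPair b m B x c e} ≤
      (circularMeasure n p).real {x | IsBlockPair b m B x d e} := by
  by_cases hcd : c = d
  · rw [hcd]
  · have := measureReal_isBlockPair_le (p := p) hB hm hc hd hcd hc he
    rwa [Equiv.swap_apply_left, Equiv.swap_apply_of_ne_of_ne hce.symm hde.symm] at this

theorem measureReal_isBlockPair_snd_le (hB : B * b ≤ n) (hm : 1 ≤ m) {c d e : ℕ} (hc : c < B)
    (hd : d < B) (he : e < B) (hce : c ≠ e) (hde : d ≠ e) :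
    (circularMeasure n p).real {x | IsBlockPair b m B x e c} ≤
      (circularMeasure n p).real {x | IsBlockPair b m B x e d} := by
  by_cases hcd : c = d
  · rw [hcd]
  · have := measureReal_isBlockPair_le (p := p) hB hm hc hd hcd he hc
    rwa [Equiv.swap_apply_left, Equiv.swap_apply_of_ne_of_ne hce.symm hde.symm] at this

/-! ### Distance between two blocks -/

/-- Encode `c` by the number of blocks from `e` forward to `c`, cyclically. If this number is `g`,
the positions are more than `(g - 1) * b` apart; letters left over after the last block only
increase the distance. -/
theorem card_near_le (hB : B * b ≤ n) (hm : 1 ≤ m) (hb : 0 < b) {e : ℕ} (he : e < B) (k : ℕ)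
    (C : Finset ℕ) (hC : ∀ c ∈ C, c < B ∧ c ≠ e ∧
      ∃ u ∈ interior n b m c, ∃ v ∈ interior n b m e, (u - v).val ≤ k) :
    C.card ≤ k / b + 1 := by
  have hmaps : Set.MapsTo (fun c => if e < c then c - e else c + B - e) C
      (Finset.Icc 1 (k / b + 1) : Finset ℕ) := by
    intro c hc
    obtain ⟨hcB, hce, u, hu, v, hv, huv⟩ := hC c hc
    rw [mem_interior_iff hB hm hcB] at hu
    rw [mem_interior_iff hB hm he] at hv
    simp only [Finset.coe_Icc, Set.mem_Icc]
    have key : ∀ g, 0 < g → g * b < b + k → g ≤ k / b + 1 := by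
      intro g hg h
      have : (g - 1) * b ≤ k := by
        rw [Nat.sub_mul]; omega
      have := (Nat.le_div_iff_mul_le hb).2 this
      omega
    split_ifs with hlt
    · refine ⟨by omega, key _ (by omega) ?_⟩
      have hval : v.val ≤ u.val := by
        have := block_disjoint b hce
        have : e * b ≤ c * b := Nat.mul_le_mul_right b hlt.le
        omega
      rw [ZMod.val_sub hval] at huv
      rw [Nat.sub_mul]; omega
    · refine ⟨by omega, key _ (by omega) ?_⟩
      have hval : u.val < v.val := by
        have := block_disjoint b hce
        have : c * b ≤ e * b := Nat.mul_le_mul_right b (by omega)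
        omega
      have h1 : (v - u) ≠ 0 := by
        intro h
        rw [sub_eq_zero] at h
        rw [h] at hval
        exact lt_irrefl _ hval
      have : NeZero (v - u) := ⟨h1⟩
      have h2 : (u - v).val = n - (v - u).val := by
        rw [← neg_sub, ZMod.val_neg_of_ne_zero]
      rw [h2, ZMod.val_sub hval.le] at huv
      have := ZMod.val_lt v
      rw [Nat.sub_mul, Nat.add_mul]; omega
  have hinj : Set.InjOn (fun c => if e < c then c - e else c + B - e) C := by
    intro c hc c' hc' h
    obtain ⟨h1, h2, -⟩ := hC c hc
    obtain ⟨h3, h4, -⟩ := hC c' hc'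
    simp only at h
    split_ifs at h <;> omega
  simpa using Finset.card_le_card_of_injOn _ hmaps hinj

/-- For fixed `e`, the hypothesis makes `τ c e` constant in `c ≠ e`, so at most `K` of the `B - 1`
terms carry at most the fraction `K / (B - 1)` of the sum. -/
theorem sum_le_div_mul_sum {τ : ℕ → ℕ → ℝ} (h0 : ∀ c e, 0 ≤ τ c e) (hB : 2 ≤ B)
    (hτ : ∀ c < B, ∀ d < B, ∀ e < B, c ≠ e → d ≠ e → τ c e ≤ τ d e)
    (C : ℕ → Finset ℕ) (hC : ∀ e < B, ∀ c ∈ C e, c < B ∧ c ≠ e) {K : ℕ}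
    (hK : ∀ e < B, (C e).card ≤ K) :
    ∑ e ∈ Finset.range B, ∑ c ∈ C e, τ c e ≤
      K / (B - 1) * ∑ e ∈ Finset.range B, ∑ c ∈ (Finset.range B).erase e, τ c e := by
  have hB1 : (0 : ℝ) < B - 1 := by
    have : (2 : ℝ) ≤ B := by exact_mod_cast hB
    linarith
  rw [Finset.mul_sum]
  refine Finset.sum_le_sum fun e he => ?_
  have heB := Finset.mem_range.1 he
  rw [div_mul_eq_mul_div, le_div_iff₀ hB1]
  have hcard : (((Finset.range B).erase e).card : ℝ) = B - 1 := by
    rw [Finset.card_erase_of_mem he, Finset.card_range, Nat.cast_sub (by omega)]; simp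
  rw [← hcard, Finset.sum_mul]
  calc ∑ c ∈ C e, τ c e * (((Finset.range B).erase e).card : ℝ)
      = ∑ c ∈ C e, ∑ d ∈ (Finset.range B).erase e, τ c e := by
        simp [mul_comm]
    _ ≤ ∑ c ∈ C e, ∑ d ∈ (Finset.range B).erase e, τ d e := by
        refine Finset.sum_le_sum fun c hc => Finset.sum_le_sum fun d hd => ?_
        obtain ⟨h1, h2⟩ := Finset.mem_erase.1 hd
        obtain ⟨h3, h4⟩ := hC e heB c hc
        exact hτ c h3 d (Finset.mem_range.1 h2) e heB h4 h1
    _ = (C e).card * ∑ d ∈ (Finset.range B).erase e, τ d e := by simp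
    _ ≤ K * ∑ d ∈ (Finset.range B).erase e, τ d e := by
        refine mul_le_mul_of_nonneg_right ?_ (Finset.sum_nonneg fun d _ => h0 d e)
        exact_mod_cast hK e heB

/-! ### The two smallest rotations and the blocks -/

variable (n A) in
/-- The circular words such that a window of length `m` is repeated, or such that one of the
windows starting at the two smallest rotations is not contained in a block. -/
def badWords (b m B : ℕ) : Set (ZMod n → A) :=
  {x | ¬ Function.Injective (window m x)} ∪
    ({x | ∃ i j, IsLowestPair x i j ∧ i ∉ interiors n b m B} ∪
      {x | ∃ i j, IsLowestPair x i j ∧ j ∉ interiors n b m B})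

/-- Each position outside the interiors hosts the smallest rotation with probability at most `1 /
n`, and likewise the second smallest: hence the factor `2`. -/
theorem measureReal_badWords_le (hB : B * b ≤ n) (hm : 1 ≤ m) (hmn : 2 * m ≤ n) {ρ : ℝ}
    (hρ0 : 0 ≤ ρ) (hρ : ∀ a, (p a).toReal ≤ ρ) :
    (circularMeasure n p).real (badWords A n b m B) ≤
      n ^ 2 * ρ ^ m + 2 * ((n - (B * (b + 1 - m) : ℕ)) / n) := by
  have hcard : (((interiors n b m B)ᶜ.card : ℕ) : ℝ) = n - (B * (b + 1 - m) : ℕ) := by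
    have h := Finset.card_add_card_compl (interiors n b m B)
    rw [card_interiors hB hm, ZMod.card] at h
    have h' : ((B * (b + 1 - m) : ℕ) : ℝ) + ((interiors n b m B)ᶜ.card : ℝ) = n := by
      exact_mod_cast h
    linarith
  have h1 : (circularMeasure n p).real
      {x | ∃ i j, IsLowestPair x i j ∧ i ∉ interiors n b m B} ≤
        (n - (B * (b + 1 - m) : ℕ)) / n := by
    have hsub : {x : ZMod n → A | ∃ i j, IsLowestPair x i j ∧ i ∉ interiors n b m B} ⊆
        ⋃ i ∈ (interiors n b m B)ᶜ, {x | ∃ j, IsLowestPair x i j} := by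
      rintro x ⟨i, j, h, hi⟩
      simp only [Set.mem_iUnion]
      exact ⟨i, Finset.mem_compl.2 hi, j, h⟩
    refine (measureReal_mono hsub (measure_ne_top _ _)).trans
      ((measureReal_biUnion_finset_le _ _).trans ?_)
    rw [← hcard, div_eq_mul_one_div, ← nsmul_eq_mul, ← Finset.sum_const]
    exact Finset.sum_le_sum fun i _ => measureReal_fst_isLowestPair_le p i
  have h2 : (circularMeasure n p).real
      {x | ∃ i j, IsLowestPair x i j ∧ j ∉ interiors n b m B} ≤
        (n - (B * (b + 1 - m) : ℕ)) / n := by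
    have hsub : {x : ZMod n → A | ∃ i j, IsLowestPair x i j ∧ j ∉ interiors n b m B} ⊆
        ⋃ j ∈ (interiors n b m B)ᶜ, {x | ∃ i, IsLowestPair x i j} := by
      rintro x ⟨i, j, h, hj⟩
      simp only [Set.mem_iUnion]
      exact ⟨j, Finset.mem_compl.2 hj, i, h⟩
    refine (measureReal_mono hsub (measure_ne_top _ _)).trans
      ((measureReal_biUnion_finset_le _ _).trans ?_)
    rw [← hcard, div_eq_mul_one_div, ← nsmul_eq_mul, ← Finset.sum_const]
    exact Finset.sum_le_sum fun i _ => measureReal_snd_isLowestPair_le p i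
  refine (measureReal_union_le _ _).trans (add_le_add
    (measureReal_not_injective_window_le hρ0 hρ hmn) ((measureReal_union_le _ _).trans ?_))
  linarith

theorem IsLowestPair.isBlockPair {x : ZMod n → A} {i j : ZMod n} (h : IsLowestPair x i j)
    (hx : Function.Injective (window m x)) {c e : ℕ} (hi : i ∈ interior n b m c)
    (hj : j ∈ interior n b m e) : IsBlockPair b m B x c e :=
  ⟨i, hi, j, hj, window_lt_of_rot_lt hx h.2.1, fun t _ hti htj =>
    window_lt_of_rot_lt hx (lt_of_le_of_ne (h.2.2 t hti) fun heq => htj (h.1 heq).symm)⟩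

theorem IsLowestPair.exists_interior {x : ZMod n → A} {i j : ZMod n} (h : IsLowestPair x i j)
    (hx : x ∉ badWords A n b m B) : Function.Injective (window m x) ∧
      ∃ c < B, i ∈ interior n b m c ∧ ∃ e < B, j ∈ interior n b m e := by
  simp only [badWords, Set.mem_union, not_or, Set.mem_ofPred_eq, not_not] at hx
  obtain ⟨h1, h2, h3⟩ := hx
  have hi : i ∈ interiors n b m B := by
    by_contra hcon
    exact h2 ⟨i, j, h, hcon⟩
  have hj : j ∈ interiors n b m B := by
    by_contra hcon
    exact h3 ⟨i, j, h, hcon⟩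
  obtain ⟨c, hc, hic⟩ := mem_interiors_iff.1 hi
  obtain ⟨e, he, hje⟩ := mem_interiors_iff.1 hj
  exact ⟨h1, c, hc, hic, e, he, hje⟩

/-- Since `m ≥ 2`, the window at `i` contains the position `i + 1`, which is therefore in the same
block. -/
theorem mem_interior_of_add_one_mem (hB : B * b ≤ n) (hm : 2 ≤ m) {c e : ℕ} (hc : c < B)
    (he : e < B) {i : ZMod n} (hi : i ∈ interior n b m c) (hi' : i + 1 ∈ interior n b m e) :
    c = e := by
  rw [mem_interior_iff hB (by omega) hc] at hi
  rw [mem_interior_iff hB (by omega) he] at hi'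
  have hcn := block_le hB hc
  have h1 : (i + 1).val = i.val + 1 := by
    conv_lhs => rw [← ZMod.natCast_zmod_val i, ← Nat.cast_one, ← Nat.cast_add]
    exact ZMod.val_cast_of_lt (by omega)
  by_contra hce
  have := block_disjoint b hce
  omega

/-- The events for distinct ordered pairs of blocks are disjoint. Apart from bad words they also
avoid consecutive lowest pairs, which lie in a single block; removing this mass produces the factor
`1 - p₁` of the limit law. -/
theorem sum_isBlockPair_le (hB : B * b ≤ n) (hm : 2 ≤ m) :
    ∑ e ∈ Finset.range B, ∑ c ∈ (Finset.range B).erase e,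
        (circularMeasure n p).real {x | IsBlockPair b m B x c e} ≤
      1 - (circularMeasure n p).real {x | ∃ i, IsLowestPair x i (i + 1)} +
        (circularMeasure n p).real (badWords A n b m B) := by
  let J := (Finset.range B).sigma fun e => (Finset.range B).erase e
  let T : (_ : ℕ) × ℕ → Set (ZMod n → A) := fun q => {x | IsBlockPair b m B x q.2 q.1}
  let Q : Set (ZMod n → A) := {x | ∃ i, IsLowestPair x i (i + 1)}
  have hJ : ∀ q ∈ J, q.1 < B ∧ q.2 < B ∧ q.2 ≠ q.1 := by
    intro q hq
    simp only [J, Finset.mem_sigma, Finset.mem_range, Finset.mem_erase] at hq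
    tauto
  rw [Finset.sum_sigma' (Finset.range B) (fun e => (Finset.range B).erase e)
    fun e c => (circularMeasure n p).real {x | IsBlockPair b m B x c e}]
  have h1 : (circularMeasure n p).real (⋃ q ∈ J, T q) =
      ∑ q ∈ J, (circularMeasure n p).real {x | IsBlockPair b m B x q.2 q.1} := by
    refine measureReal_biUnion_finset ?_ fun _ _ => MeasurableSpace.measurableSet_top
    intro q hq r hr hqr
    obtain ⟨a1, a2, -⟩ := hJ q hq
    obtain ⟨a3, a4, -⟩ := hJ r hr
    refine Set.disjoint_left.2 fun x hx hx' => hqr ?_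
    obtain ⟨h1, h2⟩ := IsBlockPair.unique hB (by omega) a2 a1 a4 a3 hx hx'
    exact Sigma.ext h2 (heq_of_eq h1)
  have h2 : Disjoint (⋃ q ∈ J, T q) (Q \ badWords A n b m B) := by
    rw [Set.disjoint_left]
    rintro x hx ⟨⟨i, hi⟩, hb⟩
    simp only [Set.mem_iUnion] at hx
    obtain ⟨q, hq, hxq⟩ := hx
    obtain ⟨hw, c, hc, hic, e, he, hje⟩ := hi.exists_interior hb
    obtain rfl := mem_interior_of_add_one_mem hB hm hc he hic hje
    obtain ⟨a1, a2, a3⟩ := hJ q hq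
    obtain ⟨h3, h4⟩ := IsBlockPair.unique hB (by omega) a2 a1 hc hc hxq (hi.isBlockPair hw hic hje)
    exact a3 (h3.trans h4.symm)
  have h3 := measureReal_union (μ := circularMeasure n p) h2 MeasurableSpace.measurableSet_top
    (measure_ne_top _ _) (measure_ne_top _ _)
  have h4 : (circularMeasure n p).real ((⋃ q ∈ J, T q) ∪ Q \ badWords A n b m B) ≤ 1 :=
    measureReal_le_one
  have h5 : (circularMeasure n p).real Q ≤ (circularMeasure n p).real (Q \ badWords A n b m B) +
      (circularMeasure n p).real (badWords A n b m B) := by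
    refine le_trans (measureReal_mono ?_ (measure_ne_top _ _)) (measureReal_union_le _ _)
    intro x hx
    by_cases hb : x ∈ badWords A n b m B
    · exact Or.inr hb
    · exact Or.inl ⟨hx, hb⟩
  change ∑ q ∈ J, (circularMeasure n p).real {x | IsBlockPair b m B x q.2 q.1} ≤
    1 - (circularMeasure n p).real Q + _
  linarith

variable {a : A}

/-- The distribution of the position of the second smallest rotation with respect to the smallest
one is almost uniform, when these positions are not consecutive. The relation `P` on positions
only relates a bounded number of blocks to a given one. -/
theorem measureReal_isLowestPair_near_le (ha : ∀ b, a ≤ b) (hB : B * b ≤ n) (hB2 : 2 ≤ B)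
    (hm : 2 ≤ m) {h M : ℕ} (hh : 0 < h) (hM : 0 < M) (hMn : M * (h + 1) ≤ n)
    (k : ℕ) (hb : 0 < b) :
    (circularMeasure n p).real {x | ∃ i j, IsLowestPair x i j ∧ j ≠ i + 1 ∧ (i - j).val ≤ k} ≤
        ((k / b + 1 : ℕ) : ℝ) / (B - 1) *
          (1 - (circularMeasure n p).real {x | ∃ i, IsLowestPair x i (i + 1)} +
            (circularMeasure n p).real (badWords A n b m B)) +
          (circularMeasure n p).real (badWords A n b m B) +
          ((1 - (p a).toReal ^ (h + 1)) ^ M + B * b ^ 2 * (p a).toReal ^ (2 * h + 1)) ∧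
    (circularMeasure n p).real {x | ∃ i j, IsLowestPair x i j ∧ j ≠ i + 1 ∧ (j - i).val ≤ k} ≤
        ((k / b + 1 : ℕ) : ℝ) / (B - 1) *
          (1 - (circularMeasure n p).real {x | ∃ i, IsLowestPair x i (i + 1)} +
            (circularMeasure n p).real (badWords A n b m B)) +
          (circularMeasure n p).real (badWords A n b m B) +
          ((1 - (p a).toReal ^ (h + 1)) ^ M + B * b ^ 2 * (p a).toReal ^ (2 * h + 1)) := by
  classical
  have hm1 : 1 ≤ m := by omega
  have hB1 : (0 : ℝ) < B - 1 := by
    have : (2 : ℝ) ≤ B := by exact_mod_cast hB2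
    linarith
  -- Pairs of positions in a common block, where exchangeability of blocks says nothing; they are
  -- handled through runs of `a`.
  let J : Finset (ZMod n × ZMod n) :=
    (Finset.range B).biUnion fun c => interior n b m c ×ˢ interior n b m c
  have hJcard : J.card ≤ B * b ^ 2 := by
    refine Finset.card_biUnion_le.trans ?_
    rw [← smul_eq_mul, ← Finset.card_range B, ← Finset.sum_const, Finset.card_range]
    refine Finset.sum_le_sum fun c hc => ?_
    rw [Finset.card_product, card_interior hB hm1 (Finset.mem_range.1 hc), sq]
    exact Nat.mul_le_mul (by omega) (by omega)
  have hJ : (circularMeasure n p).real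
      {x | ∃ i j, IsLowestPair x i j ∧ j ≠ i + 1 ∧ (i, j) ∈ J} ≤
      (1 - (p a).toReal ^ (h + 1)) ^ M + B * b ^ 2 * (p a).toReal ^ (2 * h + 1) := by
    refine (measureReal_isLowestPair_mem_le ha J hh hM hMn).trans ?_
    gcongr
    exact_mod_cast hJcard
  let C : ℕ → Finset ℕ := fun e => (Finset.range B).filter fun c => c ≠ e ∧
      ∃ u ∈ interior n b m c, ∃ v ∈ interior n b m e, (u - v).val ≤ k
  have hC : ∀ e < B, ∀ c ∈ C e, c < B ∧ c ≠ e := by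
    intro e _ c hc
    simp only [C, Finset.mem_filter, Finset.mem_range] at hc
    exact ⟨hc.1, hc.2.1⟩
  have hCcard : ∀ e < B, (C e).card ≤ k / b + 1 := by
    intro e he
    refine card_near_le hB hm1 hb he k _ fun c hc => ?_
    simpa only [C, Finset.mem_filter, Finset.mem_range] using hc
  have hsum := sum_isBlockPair_le (p := p) hB hm
  have hK : (0 : ℝ) ≤ ((k / b + 1 : ℕ) : ℝ) / (B - 1) := by positivity
  constructor
  · have hsub : {x : ZMod n → A | ∃ i j, IsLowestPair x i j ∧ j ≠ i + 1 ∧ (i - j).val ≤ k} ⊆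
        ((⋃ e ∈ Finset.range B, ⋃ c ∈ C e, {x | IsBlockPair b m B x c e}) ∪
          badWords A n b m B) ∪ {x | ∃ i j, IsLowestPair x i j ∧ j ≠ i + 1 ∧ (i, j) ∈ J} := by
      rintro x ⟨i, j, hij, hne, hk⟩
      by_cases hb : x ∈ badWords A n b m B
      · exact Or.inl (Or.inr hb)
      obtain ⟨hw, c, hc, hic, e, he, hje⟩ := hij.exists_interior hb
      by_cases hce : c = e
      · subst hce
        exact Or.inr ⟨i, j, hij, hne, Finset.mem_biUnion.2
          ⟨c, Finset.mem_range.2 hc, Finset.mem_product.2 ⟨hic, hje⟩⟩⟩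
      · refine Or.inl (Or.inl ?_)
        simp only [Set.mem_iUnion]
        refine ⟨e, Finset.mem_range.2 he, c, ?_, hij.isBlockPair hw hic hje⟩
        simp only [C, Finset.mem_filter, Finset.mem_range]
        exact ⟨hc, hce, i, hic, j, hje, hk⟩
    refine (measureReal_mono hsub (measure_ne_top _ _)).trans
      ((measureReal_union_le _ _).trans (add_le_add
        ((measureReal_union_le _ _).trans (add_le_add ?_ le_rfl)) hJ))
    refine (measureReal_biUnion_finset_le _ _).trans
      ((Finset.sum_le_sum fun e _ => measureReal_biUnion_finset_le _ _).trans ?_)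
    refine (sum_le_div_mul_sum
      (τ := fun c e => (circularMeasure n p).real {x | IsBlockPair b m B x c e})
      (fun _ _ => measureReal_nonneg) hB2 (fun c hc d hd e he hce hde =>
        measureReal_isBlockPair_fst_le hB hm1 hc hd he hce hde) C hC hCcard).trans ?_
    exact mul_le_mul_of_nonneg_left hsum hK
  -- The roles are exchanged: now the block `e` of the smallest rotation is the fixed one.
  · have hsub : {x : ZMod n → A | ∃ i j, IsLowestPair x i j ∧ j ≠ i + 1 ∧ (j - i).val ≤ k} ⊆
        ((⋃ e ∈ Finset.range B, ⋃ c ∈ C e, {x | IsBlockPair b m B x e c}) ∪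
          badWords A n b m B) ∪ {x | ∃ i j, IsLowestPair x i j ∧ j ≠ i + 1 ∧ (i, j) ∈ J} := by
      rintro x ⟨i, j, hij, hne, hk⟩
      by_cases hb : x ∈ badWords A n b m B
      · exact Or.inl (Or.inr hb)
      obtain ⟨hw, c, hc, hic, e, he, hje⟩ := hij.exists_interior hb
      by_cases hce : c = e
      · subst hce
        exact Or.inr ⟨i, j, hij, hne, Finset.mem_biUnion.2
          ⟨c, Finset.mem_range.2 hc, Finset.mem_product.2 ⟨hic, hje⟩⟩⟩
      · refine Or.inl (Or.inl ?_)
        simp only [Set.mem_iUnion]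
        refine ⟨c, Finset.mem_range.2 hc, e, ?_, hij.isBlockPair hw hic hje⟩
        simp only [C, Finset.mem_filter, Finset.mem_range]
        exact ⟨he, Ne.symm hce, j, hje, i, hic, hk⟩
    refine (measureReal_mono hsub (measure_ne_top _ _)).trans
      ((measureReal_union_le _ _).trans (add_le_add
        ((measureReal_union_le _ _).trans (add_le_add ?_ le_rfl)) hJ))
    refine (measureReal_biUnion_finset_le _ _).trans
      ((Finset.sum_le_sum fun e _ => measureReal_biUnion_finset_le _ _).trans ?_)
    refine (sum_le_div_mul_sum
      (τ := fun c e => (circularMeasure n p).real {x | IsBlockPair b m B x e c})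
      (fun _ _ => measureReal_nonneg) hB2 (fun c hc d hd e he hce hde =>
        measureReal_isBlockPair_snd_le hB hm1 hc hd he hce hde) C hC hCcard).trans ?_
    refine mul_le_mul_of_nonneg_left (le_trans (le_of_eq ?_) hsum) hK
    refine Finset.sum_comm' fun e c => ?_
    simp only [Finset.mem_erase, Finset.mem_range]
    tauto

end Blocks

/-! ### Random Lyndon words and random circular words -/

section LyndonMeasure

set_option linter.unusedSectionVars false

variable {A : Type*} [LinearOrder A] {p : PMF A} {a : A}

theorem measurableSet_words (S : Set (List A)) : MeasurableSet S :=
  MeasurableSpace.measurableSet_top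

theorem exists_pos_of_lt_one (hlt : p a < 1) : ∃ b, b ≠ a ∧ 0 < p b := by
  by_contra hcon
  push Not at hcon
  have h1 := p.tsum_coe
  rw [tsum_eq_single a fun b hb => le_antisymm (hcon b hb) bot_le] at h1
  exact hlt.ne h1

theorem wordPMF_toMeasure_lyndonWords_ne_zero (ha : ∀ b, a ≤ b) (hpos : 0 < p a) (hlt : p a < 1)
    {n : ℕ} (hn : 1 ≤ n) : (wordPMF p n).toMeasure (lyndonWords A n) ≠ 0 := by
  obtain ⟨b, hba, hb⟩ := exists_pos_of_lt_one hlt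
  have hab : a < b := lt_of_le_of_ne (ha b) hba.symm
  have hlen : (List.replicate (n - 1) a ++ [b]).length = n := by simp; omega
  have hmem : List.replicate (n - 1) a ++ [b] ∈ lyndonWords A n :=
    ⟨hlen, isLyndon_replicate_append hab _⟩
  rw [Ne, PMF.toMeasure_apply_eq_zero_iff _ (measurableSet_words _)]
  intro hd
  refine Set.disjoint_left.1 hd ?_ hmem
  rw [PMF.mem_support_iff, wordPMF_apply, if_pos hlen]
  simp [weight, hpos.ne', hb.ne']

theorem isProbabilityMeasure_lyndonMeasure (ha : ∀ b, a ≤ b) (hpos : 0 < p a) (hlt : p a < 1)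
    {n : ℕ} (hn : 1 ≤ n) : IsProbabilityMeasure (lyndonMeasure p n) :=
  cond_isProbabilityMeasure (wordPMF_toMeasure_lyndonWords_ne_zero ha hpos hlt hn)

theorem lyndonMeasure_real_apply (n : ℕ) (S : Set (List A)) :
    (lyndonMeasure p n).real S =
      (wordPMF p n).toMeasure.real (lyndonWords A n ∩ S) /
        (wordPMF p n).toMeasure.real (lyndonWords A n) := by
  rw [lyndonMeasure, measureReal_def, cond_apply (measurableSet_words _), ENNReal.toReal_mul,
    ENNReal.toReal_inv, div_eq_inv_mul, measureReal_def, measureReal_def]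

variable {n : ℕ} [NeZero n]

theorem wordPMF_toMeasure_real_apply (S : Set (List A)) :
    (wordPMF p n).toMeasure.real S = (circularMeasure n p).real {x | toWord x ∈ S} := by
  rw [measureReal_def, wordPMF_toMeasure_apply, measureReal_def]

theorem card_mul_wordPMF_toMeasure_real (hn : 2 ≤ n) (Q : ℕ → Prop) :
    n * (wordPMF p n).toMeasure.real
        (lyndonWords A n ∩ {w | Q (standardRightFactor w).length}) =
      (circularMeasure n p).real {x | ∃ i j, IsLowestPair x i j ∧ Q (i - j).val} := by
  rw [wordPMF_toMeasure_real_apply, ← card_mul_measureReal_isLowestPair]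
  congr 2
  ext x
  simp only [lyndonWords, Set.mem_inter_iff, Set.mem_ofPred_eq, length_toWord, true_and]
  constructor
  · rintro ⟨h1, h2⟩
    obtain ⟨j, hj⟩ := exists_isLowestPair_of_isLyndon hn h1
    exact ⟨j, hj, by rwa [← hj.length_standardRightFactor]⟩
  · rintro ⟨j, hj, h⟩
    exact ⟨hj.isLyndon, by rwa [hj.length_standardRightFactor]⟩

theorem card_mul_wordPMF_toMeasure_real_lyndonWords (hn : 2 ≤ n) :
    n * (wordPMF p n).toMeasure.real (lyndonWords A n) =
      (circularMeasure n p).real {x | ∃ i j, IsLowestPair x i j} := by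
  have := card_mul_wordPMF_toMeasure_real (p := p) hn (fun _ => True)
  simpa using this

theorem lyndonMeasure_real_length (hn : 2 ≤ n) (Q : ℕ → Prop) :
    (lyndonMeasure p n).real {w | Q (standardRightFactor w).length} =
      (circularMeasure n p).real {x | ∃ i j, IsLowestPair x i j ∧ Q (i - j).val} /
        (circularMeasure n p).real {x | ∃ i j, IsLowestPair x i j} := by
  have hn0 : (n : ℝ) ≠ 0 := by exact_mod_cast NeZero.ne n
  rw [lyndonMeasure_real_apply, ← card_mul_wordPMF_toMeasure_real hn,
    ← card_mul_wordPMF_toMeasure_real_lyndonWords hn, mul_div_mul_left _ _ hn0]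

theorem one_sub_le_measureReal_exists_isLowestPair (hn : 2 ≤ n) {ρ : ℝ} (hρ0 : 0 ≤ ρ)
    (hρ : ∀ a, (p a).toReal ≤ ρ) {m : ℕ} (hm : 2 * m ≤ n) :
    1 - n ^ 2 * ρ ^ m ≤ (circularMeasure n p).real {x | ∃ i j, IsLowestPair x i j} := by
  have h1 := measureReal_not_injective_window_le (p := p) hρ0 hρ hm
  have h2 : (1 : ℝ) ≤ (circularMeasure n p).real {x | ∃ i j, IsLowestPair x i j} +
      (circularMeasure n p).real {x | ¬ Function.Injective (window m x)} := by
    rw [← probReal_univ (μ := circularMeasure n p)]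
    refine (measureReal_mono ?_ (measure_ne_top _ _)).trans (measureReal_union_le _ _)
    intro x _
    by_cases h : Function.Injective (window m x)
    · exact Or.inl (exists_isLowestPair hn (rot_injective_of_window_injective h))
    · exact Or.inr h
  linarith

/-! ### The probability that the left factor has only one letter -/

theorem wordPMF_succ_cons (k : ℕ) (c : A) (v : List A) :
    wordPMF p (k + 1) (c :: v) = p c * wordPMF p k v := by
  rw [wordPMF_apply, wordPMF_apply]
  by_cases h : v.length = k <;> simp [h, weight]

theorem wordPMF_succ_toMeasure_image_cons (k : ℕ) (c : A) (S : Set (List A)) :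
    (wordPMF p (k + 1)).toMeasure (List.cons c '' S) = p c * (wordPMF p k).toMeasure S := by
  rw [PMF.toMeasure_apply _ (measurableSet_words _), PMF.toMeasure_apply _ (measurableSet_words _),
    ← ENNReal.tsum_mul_left, ← (List.cons_injective (a := c)).tsum_eq]
  · refine tsum_congr fun v => ?_
    by_cases h : v ∈ S
    · simp [h, wordPMF_succ_cons]
    · simp [h]
  · intro w hw
    obtain ⟨v, -, rfl⟩ := Set.mem_of_indicator_ne_zero hw
    exact ⟨v, rfl⟩

theorem lyndonWords_inter_length_eq {k : ℕ} (hk : 1 ≤ k) :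
    lyndonWords A (k + 1) ∩ {w | (standardRightFactor w).length = k} =
      {w | ∃ c v, w = c :: v ∧ v ∈ lyndonWords A k ∧ c :: v < v} := by
  ext w
  simp only [lyndonWords, Set.mem_inter_iff, Set.mem_ofPred_eq]
  constructor
  · rintro ⟨⟨h1, h2⟩, h3⟩
    obtain ⟨c, v, rfl⟩ := List.exists_cons_of_ne_nil (ne_nil_of_isPrimitive h2.1)
    have hvk : v.length = k := by simpa using h1
    have hv : v ≠ [] := by rintro rfl; simp at hvk; omega
    have hs := (isLeast_standardRightFactor (w := c :: v) (by omega)).1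
    rw [properSuffixes_cons c hv] at hs
    have hs' : standardRightFactor (c :: v) = v := by
      rcases hs with hs | hs
      · exact hs
      · exact hs.1.eq_of_length (by omega)
    obtain ⟨h4, h5⟩ := (isLyndon_cons_and_standardRightFactor_eq_iff hv).1 ⟨h2, hs'⟩
    exact ⟨c, v, rfl, ⟨hvk, h4⟩, h5⟩
  · rintro ⟨c, v, rfl, ⟨h1, h2⟩, h3⟩
    have hv := ne_nil_of_isPrimitive h2.1
    obtain ⟨h4, h5⟩ := (isLyndon_cons_and_standardRightFactor_eq_iff hv).2 ⟨h2, h3⟩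
    exact ⟨⟨by simp [h1], h4⟩, by rw [h5, h1]⟩

/-- The words at stake are `c :: v` with `v` Lyndon and `c :: v < v`. The letter `c = a` always
works and gives the main term; any other letter forces the whole word to avoid `a`. -/
theorem measureReal_length_eq_bounds (ha : ∀ b, a ≤ b) {k : ℕ} (hk : 2 ≤ k) :
    (p a).toReal * (wordPMF p k).toMeasure.real (lyndonWords A k) ≤
        (wordPMF p (k + 1)).toMeasure.real
          (lyndonWords A (k + 1) ∩ {w | (standardRightFactor w).length = k}) ∧
      (wordPMF p (k + 1)).toMeasure.real
          (lyndonWords A (k + 1) ∩ {w | (standardRightFactor w).length = k}) ≤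
        (p a).toReal * (wordPMF p k).toMeasure.real (lyndonWords A k) +
          (1 - (p a).toReal) ^ (k + 1) := by
  have himg : (wordPMF p (k + 1)).toMeasure.real (List.cons a '' lyndonWords A k) =
      (p a).toReal * (wordPMF p k).toMeasure.real (lyndonWords A k) := by
    rw [measureReal_def, wordPMF_succ_toMeasure_image_cons, ENNReal.toReal_mul, measureReal_def]
  rw [lyndonWords_inter_length_eq (by omega), ← himg]
  constructor
  · refine measureReal_mono ?_ (measure_ne_top _ _)
    rintro w ⟨v, hv, rfl⟩
    exact ⟨a, v, rfl, hv, hv.2.cons_lt ha (by rw [hv.1]; exact hk)⟩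
  · have h1 := measureReal_forall_not_run (n := k + 1) (p := p) a (h := 1) (M := k + 1) (by simp)
    rw [pow_one] at h1
    have h2 : (wordPMF p (k + 1)).toMeasure.real {w | w.length = k + 1 ∧ a ∉ w} ≤
        (1 - (p a).toReal) ^ (k + 1) := by
      rw [wordPMF_toMeasure_real_apply, ← h1]
      refine measureReal_mono ?_ (measure_ne_top _ _)
      rintro x ⟨-, hx⟩ q hq h3
      refine hx ?_
      have := h3 0 one_pos
      rw [toWord, List.mem_ofFn]
      exact ⟨⟨q, hq⟩, by simpa using this⟩
    refine le_trans (measureReal_mono ?_ (measure_ne_top _ _))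
      ((measureReal_union_le _ _).trans (add_le_add le_rfl h2))
    rintro w ⟨c, v, rfl, hv, hc⟩
    by_cases hca : c = a
    · exact Or.inl ⟨v, hv, by rw [hca]⟩
    · refine Or.inr ⟨by simp [hv.1], ?_⟩
      rw [List.mem_cons, not_or]
      exact ⟨Ne.symm hca, hv.2.notMem_of_cons_lt ha hca hc⟩

theorem measureReal_consecutive_bounds (ha : ∀ b, a ≤ b) {k : ℕ} (hk : 2 ≤ k) [NeZero k] :
    (p a).toReal * (circularMeasure k p).real {x | ∃ i j, IsLowestPair x i j} ≤
        (circularMeasure (k + 1) p).real {x | ∃ i, IsLowestPair x i (i + 1)} ∧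
      (circularMeasure (k + 1) p).real {x | ∃ i, IsLowestPair x i (i + 1)} ≤
        (p a).toReal + 1 / k + (k + 1) * (1 - (p a).toReal) ^ (k + 1) := by
  have hk0 : (0 : ℝ) < k := by exact_mod_cast NeZero.pos k
  have hp1 : (p a).toReal ≤ 1 := by
    have := ENNReal.toReal_mono ENNReal.one_ne_top (p.coe_le_one a)
    simpa using this
  have hp0 : 0 ≤ (p a).toReal := ENNReal.toReal_nonneg
  obtain ⟨h1, h2⟩ := measureReal_length_eq_bounds (p := p) ha hk
  have h3 := card_mul_wordPMF_toMeasure_real_lyndonWords (p := p) hk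
  have h4 := card_mul_wordPMF_toMeasure_real (p := p) (n := k + 1) (by omega) (fun l => l = k)
  have h5 : {x : ZMod (k + 1) → A | ∃ i j, IsLowestPair x i j ∧ (i - j).val = k} =
      {x | ∃ i, IsLowestPair x i (i + 1)} := by
    ext x
    simp only [Set.mem_ofPred_eq]
    refine exists_congr fun i => ?_
    -- On a circle of `k + 1` positions, a right factor of length `k` means `j = i + 1`.
    have hk1 : ((k : ℕ) : ZMod (k + 1)) = -1 := by
      rw [eq_neg_iff_add_eq_zero]
      have := ZMod.natCast_self (k + 1)
      push_cast at this
      exact this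
    constructor
    · rintro ⟨j, h, hj⟩
      have h6 : i - j = -1 := by rw [← ZMod.natCast_zmod_val (i - j), hj, hk1]
      have h7 : j = i + 1 := by linear_combination -h6
      rwa [← h7]
    · intro h
      refine ⟨i + 1, h, ?_⟩
      rw [show i - (i + 1) = -1 by ring, ← hk1, ZMod.val_cast_of_lt (by omega)]
  rw [h5] at h4
  rw [← h4, ← h3]
  set Λ := (wordPMF p k).toMeasure.real (lyndonWords A k)
  set X := (wordPMF p (k + 1)).toMeasure.real
          (lyndonWords A (k + 1) ∩ {w | (standardRightFactor w).length = k})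
  have hΛ0 : 0 ≤ Λ := measureReal_nonneg
  have hΛ : k * Λ ≤ 1 := by rw [h3]; exact measureReal_le_one
  have hX : 0 ≤ X := measureReal_nonneg
  push_cast
  constructor
  · calc (p a).toReal * (k * Λ) = k * ((p a).toReal * Λ) := by ring
      _ ≤ (k + 1) * X := by gcongr; linarith
  · have hΛ1 : Λ ≤ 1 / k := by rw [le_div_iff₀ hk0]; linarith
    have h8 : (p a).toReal * Λ ≤ 1 * (1 / k) := mul_le_mul hp1 hΛ1 hΛ0 zero_le_one
    have h9 : (p a).toReal * (k * Λ) ≤ (p a).toReal * 1 := mul_le_mul_of_nonneg_left hΛ hp0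
    have h10 : (k + 1) * X ≤ (k + 1) * ((p a).toReal * Λ + (1 - (p a).toReal) ^ (k + 1)) := by
      gcongr
    linarith

/-! ### The distribution function of the length of the standard right factor -/

/-- All errors are absorbed in one `e`, leaving the choice of parameters for later. The upper bound
requires `k + 1 < n` because the length `n - 1` carries an atom of mass close to `p a`. -/
theorem lyndonMeasure_real_length_bounds (ha : ∀ b, a ≤ b) (hpos : 0 < p a) (hlt : p a < 1)
    {ρ : ℝ} (hρ0 : 0 ≤ ρ) (hρ : ∀ a, (p a).toReal ≤ ρ) {b m B h M : ℕ} (hn : 3 ≤ n) (hb : 0 < b)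
    (hB : B * b ≤ n) (hB2 : 2 ≤ B)
    (hm : 2 ≤ m) (hmn : 2 * m ≤ n) (hh : 0 < h) (hM : 0 < M) (hMn : M * (h + 1) ≤ n)
    {e : ℝ} (he : e ≤ 1 / 2) (h1 : n ^ 2 * ρ ^ m ≤ e)
    (h2 : ((n : ℝ) - (B * (b + 1 - m) : ℕ)) / n ≤ e)
    (h3 : (1 - (p a).toReal ^ (h + 1)) ^ M + B * b ^ 2 * (p a).toReal ^ (2 * h + 1) ≤ e)
    (h4 : (p a).toReal - e ≤ (circularMeasure n p).real {x | ∃ i, IsLowestPair x i (i + 1)})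
    (h5 : (circularMeasure n p).real {x | ∃ i, IsLowestPair x i (i + 1)} ≤ (p a).toReal + e)
    (h6 : ∀ k ≤ n, ((k / b + 1 : ℕ) : ℝ) / (B - 1) ≤ k / n + e) (k : ℕ) (hk : k ≤ n) :
    (k + 1 < n → (lyndonMeasure p n).real {w | (standardRightFactor w).length ≤ k} ≤
        (1 - (p a).toReal) * (k / n) + 40 * e) ∧
      (1 - (p a).toReal) * (k / n) - 40 * e ≤
        (lyndonMeasure p n).real {w | (standardRightFactor w).length ≤ k} := by
  have hn0 : (0 : ℝ) < n := by exact_mod_cast NeZero.pos n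
  have hp1 : (p a).toReal ≤ 1 := by
    have := ENNReal.toReal_mono ENNReal.one_ne_top (p.coe_le_one a)
    simpa using this
  have hp0 : 0 ≤ (p a).toReal := ENNReal.toReal_nonneg
  have he0 : 0 ≤ e := le_trans (by positivity) h1
  have hP := isProbabilityMeasure_lyndonMeasure ha hpos hlt (n := n) (by omega)
  set q := (p a).toReal with hq
  set Q1 := (circularMeasure n p).real {x | ∃ i, IsLowestPair x i (i + 1)} with hQ1
  set bad := (circularMeasure n p).real (badWords A n b m B) with hbad
  set tot := (circularMeasure n p).real {x | ∃ i j, IsLowestPair x i j} with htot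
  have hbad3 : bad ≤ 3 * e := by
    have := measureReal_badWords_le (p := p) hB (by omega : 1 ≤ m) hmn hρ0 hρ
    linarith
  have hbad0 : 0 ≤ bad := measureReal_nonneg
  have htot1 : tot ≤ 1 := measureReal_le_one
  have htot0 : 1 - e ≤ tot := by
    have := one_sub_le_measureReal_exists_isLowestPair (p := p) (n := n) (by omega) hρ0 hρ hmn
    linarith
  -- Expanding `(l / n + e) * ((1 - q) + 4 * e)` with `e ≤ 1 / 2` costs at most `7 * e`; the bad
  -- words add `3 * e` and the pairs in one block add `e`.
  have hnear : ∀ l ≤ n, ((l / b + 1 : ℕ) : ℝ) / (B - 1) * (1 - Q1 + bad) + bad +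
      ((1 - q ^ (h + 1)) ^ M + B * b ^ 2 * q ^ (2 * h + 1)) ≤ (1 - q) * (l / n) + 11 * e := by
    intro l hl
    have hl1 : (l : ℝ) / n ≤ 1 := by
      rw [div_le_one hn0]; exact_mod_cast hl
    have hl0 : (0 : ℝ) ≤ l / n := by positivity
    have hx : 1 - Q1 + bad ≤ (1 - q) + 4 * e := by linarith
    have hx0 : 0 ≤ 1 - Q1 + bad := by
      have : Q1 ≤ 1 := measureReal_le_one
      linarith
    have : ((l / b + 1 : ℕ) : ℝ) / (B - 1) * (1 - Q1 + bad) ≤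
        (l / n + e) * ((1 - q) + 4 * e) := mul_le_mul (h6 l hl) hx hx0 (by positivity)
    nlinarith [mul_nonneg he0 hp0, mul_le_mul_of_nonneg_right hl1 he0,
      mul_le_mul_of_nonneg_right he he0]
  -- Conditioning on distinct rotations divides by `tot ≥ 1 - e`; the constant `16` suffices since
  -- `Y ≤ 8` and `e ≤ 1 / 2`.
  have hdiv : ∀ X Y : ℝ, X ≤ Y → 0 ≤ Y → Y ≤ 8 → X / tot ≤ Y + 16 * e := by
    intro X Y hXY hY0 hY
    have ht : 0 < tot := by linarith
    rw [div_le_iff₀ ht]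
    nlinarith [mul_nonneg he0 hY0, mul_nonneg he0 he0, mul_le_mul_of_nonneg_left htot0
      (by linarith : 0 ≤ Y + 16 * e), mul_le_mul_of_nonneg_right he he0]
  obtain ⟨hn1, -⟩ := measureReal_isLowestPair_near_le (p := p) ha hB hB2 hm hh hM hMn k hb
  obtain ⟨-, hn2⟩ := measureReal_isLowestPair_near_le (p := p) ha hB hB2 hm hh hM hMn (n - k) hb
  have hk1 : (k : ℝ) / n ≤ 1 := by
    rw [div_le_one hn0]; exact_mod_cast hk
  have hk0 : (0 : ℝ) ≤ k / n := by positivity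
  have hqk : (1 - q) * (k / n) ≤ 1 := by nlinarith
  have hqk0 : 0 ≤ (1 - q) * (k / n) := mul_nonneg (by linarith) hk0
  have hval1 : ∀ i : ZMod n, (i - (i + 1)).val = n - 1 := by
    intro i
    have h7 : ((n - 1 : ℕ) : ZMod n) = -1 := by
      rw [Nat.cast_sub (by omega)]; simp
    rw [show i - (i + 1) = -1 by ring, ← h7, ZMod.val_cast_of_lt (by omega)]
  constructor
  · intro hkn
    rw [lyndonMeasure_real_length (by omega) (fun l => l ≤ k)]
    have hsub : {x : ZMod n → A | ∃ i j, IsLowestPair x i j ∧ (i - j).val ≤ k} ⊆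
        {x | ∃ i j, IsLowestPair x i j ∧ j ≠ i + 1 ∧ (i - j).val ≤ k} := by
      rintro x ⟨i, j, hij, hv⟩
      refine ⟨i, j, hij, ?_, hv⟩
      rintro rfl
      rw [hval1] at hv
      omega
    have := hdiv _ _ (((measureReal_mono hsub (measure_ne_top _ _)).trans hn1).trans (hnear k hk))
      (by linarith) (by linarith)
    linarith
  · have hcompl : (lyndonMeasure p n).real {w | (standardRightFactor w).length ≤ k} =
        1 - (lyndonMeasure p n).real {w | k < (standardRightFactor w).length} := by
      rw [← probReal_compl_eq_one_sub (measurableSet_words _)]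
      congr 1
      ext w
      simp
    rw [hcompl, lyndonMeasure_real_length (by omega) (fun l => k < l)]
    -- The lower bound comes from the complement: a long right factor means either the atom or a
    -- small distance from `i` forward to `j`.
    have hsub : {x : ZMod n → A | ∃ i j, IsLowestPair x i j ∧ k < (i - j).val} ⊆
        {x | ∃ i, IsLowestPair x i (i + 1)} ∪
          {x | ∃ i j, IsLowestPair x i j ∧ j ≠ i + 1 ∧ (j - i).val ≤ n - k} := by
      rintro x ⟨i, j, hij, hv⟩
      by_cases hj : j = i + 1
      · exact Or.inl ⟨i, hj ▸ hij⟩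
      · refine Or.inr ⟨i, j, hij, hj, ?_⟩
        have : NeZero (i - j) := ⟨sub_ne_zero.2 hij.ne⟩
        rw [← neg_sub, ZMod.val_neg_of_ne_zero]
        omega
    have h7 := (measureReal_mono hsub (measure_ne_top _ _)).trans
      ((measureReal_union_le _ _).trans (add_le_add h5 (hn2.trans (hnear (n - k) (Nat.sub_le _ _)))))
    have h8 : (1 - q) * (((n - k : ℕ) : ℝ) / n) = (1 - q) - (1 - q) * (k / n) := by
      rw [Nat.cast_sub hk]; field_simp
    rw [h8] at h7
    have := hdiv _ _ h7 (by linarith) (by linarith)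
    linarith

end LyndonMeasure

/-! ### Asymptotics -/

section Asymptotics

theorem near_div_le {n b B k : ℕ} (hb : 0 < b) (hB1 : B * b ≤ n) (hB2 : n < B * b + b)
    (hB : 2 ≤ B) (hk : k ≤ n) :
    ((k / b + 1 : ℕ) : ℝ) / (B - 1) ≤ k / n + 3 / (B - 1) := by
  have hB' : (2 : ℝ) ≤ B := by exact_mod_cast hB
  have hb' : (0 : ℝ) < b := by exact_mod_cast hb
  have h1 : (B : ℝ) * b ≤ n := by exact_mod_cast hB1
  have h2 : (n : ℝ) < B * b + b := by exact_mod_cast hB2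
  have hn : (0 : ℝ) < n := by nlinarith
  have hk' : (k : ℝ) ≤ n := by exact_mod_cast hk
  have h3 : ((k / b : ℕ) : ℝ) ≤ k / b := Nat.cast_div_le
  have h4 : (0 : ℝ) < B - 1 := by linarith
  have h5 : (k : ℝ) / b ≤ k / n * (B - 1) + 2 := by
    rw [div_le_iff₀ hb', div_mul_eq_mul_div, add_mul, div_mul_eq_mul_div, ← sub_le_iff_le_add,
      le_div_iff₀ hn]
    nlinarith [mul_le_mul_of_nonneg_left h2.le (Nat.cast_nonneg (α := ℝ) k),
      mul_le_mul_of_nonneg_right hk' hb'.le]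
  rw [div_le_iff₀ h4, add_mul, div_mul_cancel₀ _ h4.ne']
  push_cast
  linarith

theorem pow_floor_bounds {q : ℝ} (hq0 : 0 < q) (hq1 : q < 1) {y : ℝ} (hy : 0 ≤ y) :
    Real.exp (-y) ≤ q ^ ⌊y / (-Real.log q)⌋₊ ∧ q ^ (⌊y / (-Real.log q)⌋₊ + 1) ≤ Real.exp (-y) := by
  have hl : 0 < -Real.log q := neg_pos.2 (Real.log_neg hq0 hq1)
  have hpow : ∀ k : ℕ, q ^ k = Real.exp (-(k * (-Real.log q))) := by
    intro k
    rw [← Real.exp_log hq0, ← Real.exp_nat_mul, Real.log_exp]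
    congr 1; ring
  rw [hpow, hpow, Real.exp_le_exp, Real.exp_le_exp]
  constructor
  · have := Nat.floor_le (div_nonneg hy hl.le)
    rw [le_div_iff₀ hl] at this
    linarith
  · have := (Nat.lt_floor_add_one (y / (-Real.log q))).le
    rw [div_le_iff₀ hl] at this
    push_cast
    linarith

theorem pow_ceil_le {ρ : ℝ} (hρ0 : 0 < ρ) (hρ1 : ρ < 1) {y : ℝ} {m : ℕ}
    (hm : y / (-Real.log ρ) ≤ m) : ρ ^ m ≤ Real.exp (-y) := by
  have hl : 0 < -Real.log ρ := neg_pos.2 (Real.log_neg hρ0 hρ1)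
  rw [div_le_iff₀ hl] at hm
  rw [← Real.exp_log hρ0, ← Real.exp_nat_mul, Real.exp_le_exp]
  linarith

theorem one_sub_pow_le_exp {t : ℝ} (ht : t ≤ 1) (M : ℕ) : (1 - t) ^ M ≤ Real.exp (-(M * t)) := by
  have h1 : 1 - t ≤ Real.exp (-t) := by
    have := Real.add_one_le_exp (-t)
    linarith
  calc (1 - t) ^ M ≤ Real.exp (-t) ^ M := pow_le_pow_left₀ (by linarith) h1 M
    _ = Real.exp (-(M * t)) := by rw [← Real.exp_nat_mul]; congr 1; ring

/-- The rate of convergence. -/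
noncomputable def rate (ε : ℝ) (n : ℕ) : ℝ := (n : ℝ) ^ (-(1 / 2) + ε) * Real.log n

theorem tendsto_rate {ε : ℝ} (h : ε < 1 / 2) : Tendsto (rate ε) atTop (𝓝 0) := by
  have h1 : (fun x : ℝ => Real.log x) =o[atTop] fun x => x ^ (1 / 2 - ε) :=
    isLittleO_log_rpow_atTop (by linarith)
  have h2 := h1.tendsto_div_nhds_zero.comp tendsto_natCast_atTop_atTop
  refine h2.congr fun n => ?_
  simp only [Function.comp_apply, rate]
  rw [show -(1 / 2) + ε = -(1 / 2 - ε) by ring, Real.rpow_neg (Nat.cast_nonneg n)]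
  ring

theorem inv_sqrt_mul_log_le_rate {ε : ℝ} (hε : 0 < ε) {n : ℕ} (hn : 1 ≤ n) :
    (Real.sqrt n)⁻¹ * Real.log n ≤ rate ε n := by
  have hn' : (1 : ℝ) ≤ n := by exact_mod_cast hn
  unfold rate
  refine mul_le_mul_of_nonneg_right ?_ (Real.log_nonneg hn')
  rw [Real.sqrt_eq_rpow, ← Real.rpow_neg (by linarith)]
  exact Real.rpow_le_rpow_of_exponent_le hn' (by linarith)

theorem eventually_log_ge (K : ℝ) : ∀ᶠ n : ℕ in atTop, K ≤ Real.log n :=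
  (Real.tendsto_log_atTop.comp tendsto_natCast_atTop_atTop).eventually_ge_atTop K

theorem eventually_mul_log_le_sqrt (K : ℝ) :
    ∀ᶠ n : ℕ in atTop, K * Real.log n ≤ Real.sqrt n := by
  have h1 : (fun x : ℝ => K * Real.log x) =o[atTop] fun x => x ^ (1 / 2 : ℝ) :=
    (isLittleO_log_rpow_atTop (by norm_num)).const_mul_left K
  have h2 := tendsto_natCast_atTop_atTop (R := ℝ) |>.eventually (h1.bound one_pos)
  filter_upwards [h2] with n hn
  rw [one_mul, ← Real.sqrt_eq_rpow, Real.norm_of_nonneg (Real.sqrt_nonneg _)] at hn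
  exact (Real.le_norm_self _).trans hn

theorem eventually_log_sq_le {c ε : ℝ} (hc : 0 < c) (hε : 0 < ε) :
    ∀ᶠ n : ℕ in atTop, Real.log n ^ 2 ≤ c * (n : ℝ) ^ ε := by
  have h1 : (fun x : ℝ => Real.log x ^ (2 : ℝ)) =o[atTop] fun x => x ^ ε :=
    isLittleO_log_rpow_rpow_atTop 2 hε
  have h2 := tendsto_natCast_atTop_atTop (R := ℝ) |>.eventually (h1.bound hc)
  filter_upwards [h2] with n hn
  rw [Real.norm_of_nonneg (Real.rpow_nonneg (Nat.cast_nonneg n) _), Real.rpow_two] at hn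
  exact (Real.le_norm_self _).trans hn

theorem eventually_mul_pow_le {t : ℝ} (h0 : 0 ≤ t) (h1 : t < 1) :
    ∀ᶠ n : ℕ in atTop, n * t ^ n ≤ (Real.sqrt n)⁻¹ := by
  have h2 := tendsto_pow_const_mul_const_pow_of_abs_lt_one 2 (r := t) (by rwa [abs_of_nonneg h0])
  filter_upwards [h2.eventually_le_const zero_lt_one, eventually_ge_atTop 1] with n hn hn1
  have hn' : (1 : ℝ) ≤ n := by exact_mod_cast hn1
  have hs : (1 : ℝ) ≤ Real.sqrt n := Real.one_le_sqrt.2 hn'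
  have hss : Real.sqrt n * Real.sqrt n = n := Real.mul_self_sqrt (by linarith)
  rw [← one_div, le_div_iff₀ (by positivity)]
  calc n * t ^ n * Real.sqrt n ≤ n * t ^ n * n := by
        gcongr
        nlinarith
    _ = (n : ℝ) ^ 2 * t ^ n := by ring
    _ ≤ 1 := hn

/-- The length `h` is chosen so that `q ^ h` is about `n ^ (-(1 - ε))`: short enough that some run
of length `h + 1` almost surely appears as `n` grows, long enough that two prescribed runs cost `n ^
(-2 + 2 * ε)`. -/
theorem eventually_no_run_le {q ε : ℝ} (hq0 : 0 < q) (hq1 : q < 1) (hε : 0 < ε) (hε1 : ε < 1) :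
    ∀ᶠ n : ℕ in atTop, ∀ h : ℕ, h = ⌊(1 - ε) * Real.log n / (-Real.log q)⌋₊ →
      0 < h ∧ 0 < n / (h + 1) ∧ (1 - q ^ (h + 1)) ^ (n / (h + 1)) ≤ (Real.sqrt n)⁻¹ ∧
        q ^ (2 * h + 1) ≤ q⁻¹ * (n : ℝ) ^ (-2 + 2 * ε) := by
  have hl : 0 < -Real.log q := neg_pos.2 (Real.log_neg hq0 hq1)
  set l := -Real.log q with hldef
  have hc : 0 < q / (1 / l + 1) := by positivity
  filter_upwards [eventually_log_ge 1, eventually_log_ge (l / (1 - ε)),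
    eventually_mul_log_le_sqrt (1 / l + 1), eventually_log_sq_le hc hε, eventually_ge_atTop 1]
    with n hL1 hL2 hL3 hL4 hn h hh
  have hn' : (1 : ℝ) ≤ n := by exact_mod_cast hn
  have hn0 : (0 : ℝ) < n := by linarith
  set L := Real.log n with hLdef
  have hL0 : 0 < L := by linarith
  have hy : 0 ≤ (1 - ε) * L := mul_nonneg (by linarith) (by linarith)
  obtain ⟨h1, h2⟩ := pow_floor_bounds hq0 hq1 hy
  rw [← hldef, ← hh] at h1 h2
  have hexp : Real.exp (-((1 - ε) * L)) = (n : ℝ) ^ (-(1 - ε)) := by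
    rw [Real.rpow_def_of_pos hn0]; congr 1; ring
  have hh0 : 0 < h := by
    rw [hh]
    refine Nat.floor_pos.2 ?_
    rw [div_le_iff₀ (by linarith)] at hL2
    rw [le_div_iff₀ hl]; linarith
  have hhL : ((h + 1 : ℕ) : ℝ) ≤ (1 / l + 1) * L := by
    have : (h : ℝ) ≤ (1 - ε) * L / l := by
      rw [hh]; exact Nat.floor_le (div_nonneg hy hl.le)
    have h3 : (1 - ε) * L / l ≤ L / l := by
      gcongr
      nlinarith
    push_cast
    have h4 : (1 / l + 1) * L = L / l + L := by ring
    linarith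
  have hsn : Real.sqrt n ≤ n := by
    rw [Real.sqrt_le_left (by linarith)]; nlinarith
  have hhn : h + 1 ≤ n := by
    have : ((h + 1 : ℕ) : ℝ) ≤ n := by linarith
    exact_mod_cast this
  have hM0 : 0 < n / (h + 1) := Nat.div_pos hhn (Nat.succ_pos h)
  have hM : (n : ℝ) ≤ 2 * ((n / (h + 1) : ℕ) : ℝ) * ((h + 1 : ℕ) : ℝ) := by
    have h3 : n ≤ 2 * (n / (h + 1)) * (h + 1) := by
      have h4 := Nat.lt_div_mul_add (a := n) (b := h + 1) (Nat.succ_pos h)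
      have h5 : h + 1 ≤ n / (h + 1) * (h + 1) := Nat.le_mul_of_pos_left _ hM0
      rw [mul_assoc]; omega
    exact_mod_cast h3
  refine ⟨hh0, hM0, ?_, ?_⟩
  · refine (one_sub_pow_le_exp (pow_le_one₀ hq0.le hq1.le) _).trans ?_
    -- It remains to see that `L / 2` is at most the number of arcs times `q ^ (h + 1)`. This
    -- product is at least of order `n ^ ε / L`, so the comparison of `L ^ 2` with `n ^ ε` suffices.
    rw [Real.sqrt_eq_rpow, ← Real.rpow_neg hn0.le, Real.rpow_def_of_pos hn0, Real.exp_le_exp]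
    have h3 : q * (n : ℝ) ^ (-(1 - ε)) ≤ q ^ (h + 1) := by
      rw [pow_succ', ← hexp]
      exact mul_le_mul_of_nonneg_left h1 hq0.le
    have h4 : (n : ℝ) ^ (-(1 - ε)) * n = (n : ℝ) ^ ε := by
      nth_rewrite 2 [← Real.rpow_one (n : ℝ)]
      rw [← Real.rpow_add hn0]; congr 1; ring
    have h5 : q * (n : ℝ) ^ ε ≤ 2 * ((n / (h + 1) : ℕ) : ℝ) * ((1 / l + 1) * L) * q ^ (h + 1) := by
      calc q * (n : ℝ) ^ ε = (q * (n : ℝ) ^ (-(1 - ε))) * n := by rw [← h4]; ring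
        _ ≤ q ^ (h + 1) * (2 * ((n / (h + 1) : ℕ) : ℝ) * ((h + 1 : ℕ) : ℝ)) := by gcongr
        _ ≤ q ^ (h + 1) * (2 * ((n / (h + 1) : ℕ) : ℝ) * ((1 / l + 1) * L)) := by gcongr
        _ = _ := by ring
    have h6 : (1 / l + 1) * L ^ 2 ≤ q * (n : ℝ) ^ ε := by
      rw [div_mul_eq_mul_div, le_div_iff₀ (by positivity)] at hL4
      linarith
    have h7 : 0 < (1 / l + 1) * L := by positivity
    have h8 : (1 / l + 1) * L * L ≤
        (1 / l + 1) * L * (2 * ((n / (h + 1) : ℕ) : ℝ) * q ^ (h + 1)) := by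
      calc (1 / l + 1) * L * L = (1 / l + 1) * L ^ 2 := by ring
        _ ≤ _ := h6.trans h5
        _ = _ := by ring
    have h9 := le_of_mul_le_mul_left h8 h7
    rw [← hLdef]
    linarith
  · have h3 : q ^ (2 * h + 1) = q⁻¹ * (q ^ (h + 1)) ^ 2 := by
      rw [← pow_mul, show (h + 1) * 2 = (2 * h + 1) + 1 by ring, pow_succ _ (2 * h + 1)]
      field_simp
    have h4 : (n : ℝ) ^ (-2 + 2 * ε) = ((n : ℝ) ^ (-(1 - ε))) ^ 2 := by
      rw [← Real.rpow_natCast, ← Real.rpow_mul hn0.le]; congr 1; push_cast; ring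
    rw [h3, h4, ← hexp]
    gcongr

end Asymptotics

/-! ### Choice of the parameters and the resulting rate -/

section Rate

variable {A : Type*} {p : PMF A} {a : A}

/-- Gives a uniform bound below `1` on letter probabilities, valid also for infinite alphabets. -/
theorem toReal_le_max (b : A) : (p b).toReal ≤ max (p a).toReal (1 - (p a).toReal) := by
  classical
  by_cases hba : b = a
  · subst hba; exact le_max_left _ _
  · refine le_max_of_le_right ?_
    have h1 : p a + p b ≤ 1 := by
      rw [← p.tsum_coe, ← Finset.sum_pair (f := fun c => p c) (Ne.symm hba)]
      exact ENNReal.sum_le_tsum _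
    have h2 := ENNReal.toReal_mono ENNReal.one_ne_top h1
    rw [ENNReal.toReal_add (p.apply_ne_top a) (p.apply_ne_top b), ENNReal.toReal_one] at h2
    linarith

variable [LinearOrder A]

set_option maxHeartbeats 1000000 in
theorem exists_length_bounds (ha : ∀ b, a ≤ b) (hpos : 0 < p a) (hlt : p a < 1) {ε : ℝ}
    (hε : 0 < ε) (hε1 : ε < 1 / 2) :
    ∃ K : ℝ, 0 ≤ K ∧ ∀ᶠ n : ℕ in atTop, ∀ k ≤ n,
      (k + 1 < n → (lyndonMeasure p n).real {w | (standardRightFactor w).length ≤ k} ≤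
        (1 - (p a).toReal) * (k / n) + K * rate ε n) ∧
      (1 - (p a).toReal) * (k / n) - K * rate ε n ≤
        (lyndonMeasure p n).real {w | (standardRightFactor w).length ≤ k} := by
  have hq0 : 0 < (p a).toReal := ENNReal.toReal_pos hpos.ne' (p.apply_ne_top a)
  have hq1 : (p a).toReal < 1 := by
    have := (ENNReal.toReal_lt_toReal (p.apply_ne_top a) ENNReal.one_ne_top).2 hlt
    simpa using this
  set q := (p a).toReal with hq
  set ρ := max q (1 - q) with hρdef
  have hρ0 : 0 < ρ := lt_max_of_lt_left hq0
  have hρ1 : ρ < 1 := max_lt hq1 (by linarith)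
  have hρ : ∀ b, (p b).toReal ≤ ρ := toReal_le_max
  have hl : 0 < -Real.log ρ := neg_pos.2 (Real.log_neg hρ0 hρ1)
  -- Windows of length `K₁ * log n` make `ρ ^ m ≤ n ^ (-3)`, which beats the `n ^ 2` pairs of
  -- positions.
  set K₁ := 3 / (-Real.log ρ) with hK₁
  have hK₁0 : 0 < K₁ := by positivity
  -- Dominates the coefficients `1`, `7 + 2 * K₁`, `1 + q⁻¹`, `3` and `6` of the separate errors
  -- below.
  set K₀ := 20 + 2 * K₁ + q⁻¹ with hK₀
  have hK₀0 : 0 < K₀ := by positivity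
  refine ⟨40 * K₀, by positivity, ?_⟩
  have hsmall : ∀ᶠ n : ℕ in atTop, K₀ * rate ε n ≤ 1 / 2 := by
    have := (tendsto_rate hε1).const_mul K₀
    rw [mul_zero] at this
    exact this.eventually_le_const (by norm_num)
  filter_upwards [hsmall, eventually_log_ge 1, eventually_mul_log_le_sqrt (2 * K₁ + 8),
    eventually_mul_pow_le (t := 1 - q) (by linarith) (by linarith),
    eventually_no_run_le hq0 hq1 (half_pos hε) (by linarith), eventually_ge_atTop 4]
    with n he hL hLs hpow hrun hn k hk
  have : NeZero n := ⟨by omega⟩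
  have hn' : (4 : ℝ) ≤ n := by exact_mod_cast hn
  have hn0 : (0 : ℝ) < n := by linarith
  set L := Real.log n with hLdef
  set s := Real.sqrt n with hs
  have hs8 : 8 ≤ s := by linarith [mul_nonneg hK₁0.le (by linarith : 0 ≤ L)]
  have hs0 : 0 < s := by linarith
  have hss : s * s = n := Real.mul_self_sqrt hn0.le
  have hss8 : 8 * s ≤ s * s := mul_le_mul_of_nonneg_right hs8 hs0.le
  have hsL : s ≤ s * L := le_mul_of_one_le_right hs0.le hL
  have hz : s⁻¹ ≤ s⁻¹ * L := le_mul_of_one_le_right (by positivity) hL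
  have hr : s⁻¹ * L ≤ rate ε n := inv_sqrt_mul_log_le_rate hε (by omega)
  have hr0 : 0 < rate ε n := lt_of_lt_of_le (by positivity) hr
  obtain ⟨hh0, hM0, hrun1, hrun2⟩ := hrun _ rfl
  set h := ⌊(1 - ε / 2) * L / (-Real.log q)⌋₊
  set b := Nat.sqrt n with hb
  set B := n / b with hBdef
  set m := ⌈K₁ * L⌉₊ + 2 with hm
  have hbs : (b : ℝ) ≤ s := Real.nat_sqrt_le_real_sqrt
  have hsb : s ≤ b + 1 := Real.real_sqrt_le_nat_sqrt_succ
  have hb0 : 0 < b := by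
    have : (0 : ℝ) < b := by linarith
    exact_mod_cast this
  have hBb : B * b ≤ n := Nat.div_mul_le_self n b
  have hBb' : n < B * b + b := Nat.lt_div_mul_add hb0
  have hbB : b ≤ B := (Nat.le_div_iff_mul_le hb0).2 (Nat.sqrt_le n)
  have hBbR : (B : ℝ) * b ≤ n := by exact_mod_cast hBb
  have hBbR' : (n : ℝ) < B * b + b := by exact_mod_cast hBb'
  have hbBR : (b : ℝ) ≤ B := by exact_mod_cast hbB
  have hmR : (m : ℝ) ≤ K₁ * L + 3 := by
    have := (Nat.ceil_lt_add_one (mul_nonneg hK₁0.le (by linarith : 0 ≤ L))).le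
    rw [hm]; push_cast; linarith
  have hms : 2 * (m : ℝ) ≤ s - 2 := by linarith
  have hmb : m ≤ b := by
    have : (m : ℝ) ≤ b := by
      have : (0 : ℝ) ≤ m := Nat.cast_nonneg m
      linarith
    exact_mod_cast this
  have hmn : 2 * m + 2 ≤ n := by
    have : (2 : ℝ) * m + 2 ≤ n := by linarith
    exact_mod_cast this
  have hB2R : s / 2 ≤ (B : ℝ) - 1 := by linarith
  have hB2 : 2 ≤ B := by
    have : (2 : ℝ) ≤ B := by linarith
    exact_mod_cast this
  have hcol : (n : ℝ) ^ 2 * ρ ^ m ≤ s⁻¹ := by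
    have h1 : ρ ^ m ≤ Real.exp (-(3 * L)) := by
      refine pow_ceil_le hρ0 hρ1 ?_
      have h2 := Nat.le_ceil (K₁ * L)
      have h3 : 3 * L / (-Real.log ρ) = K₁ * L := by rw [hK₁]; ring
      rw [h3, hm]; push_cast; linarith
    have h2 : Real.exp (-(3 * L)) = ((n : ℝ) ^ 3)⁻¹ := by
      rw [Real.exp_neg, hLdef, show (3 : ℝ) * Real.log n = ((3 : ℕ) : ℝ) * Real.log n by norm_num,
        Real.exp_nat_mul, Real.exp_log hn0]
    calc (n : ℝ) ^ 2 * ρ ^ m ≤ n ^ 2 * ((n : ℝ) ^ 3)⁻¹ := by rw [← h2]; gcongr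
      _ = (n : ℝ)⁻¹ := by field_simp
      _ ≤ s⁻¹ := inv_anti₀ hs0 (by linarith)
  have hfrac : ((n : ℝ) - (B * (b + 1 - m) : ℕ)) / n ≤ (7 + 2 * K₁) * (s⁻¹ * L) := by
    rw [Nat.cast_mul, Nat.cast_sub (by omega), div_le_iff₀ hn0]
    push_cast
    have h1 : (B : ℝ) ≤ 2 * s := by
      have : (B : ℝ) * (s / 2) ≤ n := by
        refine le_trans ?_ hBbR
        gcongr
        linarith
      rw [← hss] at this
      have h2 : s * (B : ℝ) ≤ s * (2 * s) := by linarith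
      exact le_of_mul_le_mul_left h2 hs0
    have h2 : (7 + 2 * K₁) * (s⁻¹ * L) * n = (7 + 2 * K₁) * L * s := by
      rw [← hss]; field_simp
    rw [h2]
    have h3 : (B : ℝ) * m ≤ 2 * s * (K₁ * L + 3) := by gcongr
    have h4 : 0 ≤ (B : ℝ) := Nat.cast_nonneg B
    linarith
  -- About `n ^ (3 / 2)` pairs in a common block, each costing `n ^ (-2 + ε)`; this is why the runs
  -- were chosen with `ε / 2`.
  have hγ : (B : ℝ) * b ^ 2 * q ^ (2 * h + 1) ≤ q⁻¹ * rate ε n := by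
    have h1 : (B : ℝ) * b ^ 2 ≤ n * s := by
      rw [sq, ← mul_assoc]
      gcongr
    have h2 : (n : ℝ) * s * (n : ℝ) ^ (-2 + 2 * (ε / 2)) = (n : ℝ) ^ (-(1 / 2) + ε) := by
      rw [hs, Real.sqrt_eq_rpow]
      nth_rewrite 1 [← Real.rpow_one (n : ℝ)]
      rw [← Real.rpow_add hn0, ← Real.rpow_add hn0]
      congr 1; ring
    calc (B : ℝ) * b ^ 2 * q ^ (2 * h + 1)
        ≤ n * s * (q⁻¹ * (n : ℝ) ^ (-2 + 2 * (ε / 2))) := by gcongr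
      _ = q⁻¹ * (n : ℝ) ^ (-(1 / 2) + ε) := by rw [← h2]; ring
      _ ≤ q⁻¹ * rate ε n := by
        unfold rate
        gcongr
        exact le_mul_of_one_le_right (by positivity) hL
  have hcons : q - s⁻¹ ≤ (circularMeasure n p).real {x | ∃ i, IsLowestPair x i (i + 1)} ∧
      (circularMeasure n p).real {x | ∃ i, IsLowestPair x i (i + 1)} ≤ q + 3 * s⁻¹ := by
    obtain ⟨l, rfl⟩ : ∃ l, n = l + 1 := ⟨n - 1, by omega⟩
    have : NeZero l := ⟨by omega⟩
    obtain ⟨h1, h2⟩ := measureReal_consecutive_bounds (p := p) ha (k := l) (by omega)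
    rw [← hq] at h1 h2
    have h3 := one_sub_le_measureReal_exists_isLowestPair (p := p) (n := l) (by omega) hρ0.le hρ
      (m := m) (by omega)
    have h4 : (l : ℝ) ^ 2 * ρ ^ m ≤ s⁻¹ := by
      refine le_trans ?_ hcol
      gcongr
      simp
    have hl1 : (l : ℝ) + 1 = s * s := by rw [hss]; push_cast; ring
    constructor
    · have h5 : q * (1 - s⁻¹) ≤
          q * (circularMeasure l p).real {x | ∃ i j, IsLowestPair x i j} := by
        gcongr
        linarith
      have h6 : q * s⁻¹ ≤ s⁻¹ := mul_le_of_le_one_left (inv_nonneg.2 hs0.le) hq1.le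
      linarith
    · have h5 : 1 / (l : ℝ) ≤ s⁻¹ := by
        rw [← one_div]
        exact one_div_le_one_div_of_le hs0 (by linarith)
      push_cast at hpow
      have h6 : 0 < s⁻¹ := by positivity
      linarith
  have hB3 : 3 / ((B : ℝ) - 1) ≤ 6 * s⁻¹ := by
    rw [div_le_iff₀ (by linarith)]
    calc (3 : ℝ) = 6 * s⁻¹ * (s / 2) := by field_simp; norm_num
      _ ≤ 6 * s⁻¹ * (B - 1) := by gcongr
  have hqinv : 0 < q⁻¹ := by positivity
  have hkey : ∀ c x : ℝ, c ≤ 20 + 2 * K₁ + q⁻¹ → x ≤ c * rate ε n → x ≤ K₀ * rate ε n :=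
    fun c x hc hx => hx.trans (mul_le_mul_of_nonneg_right hc hr0.le)
  have hsr : s⁻¹ ≤ rate ε n := hz.trans hr
  have hmain := lyndonMeasure_real_length_bounds (p := p) ha hpos hlt hρ0.le hρ (b := b) (m := m)
    (B := B) (h := h) (M := n / (h + 1)) (e := K₀ * rate ε n) (by omega : 3 ≤ n) hb0 hBb hB2
    (by omega) (by omega) hh0 hM0 (Nat.div_mul_le_self _ _) he
    (hkey 1 _ (by linarith) (by linarith))
    (hkey (7 + 2 * K₁) _ (by linarith) (hfrac.trans (by gcongr)))
    (hkey (1 + q⁻¹) _ (by linarith) (by linarith))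
    (by
      have := hkey 1 _ (by linarith) (by linarith : s⁻¹ ≤ 1 * rate ε n)
      linarith [hcons.1])
    (by
      have := hkey 3 _ (by linarith) (by linarith : 3 * s⁻¹ ≤ 3 * rate ε n)
      linarith [hcons.2])
    (fun l hl => (near_div_le hb0 hBb hBb' hB2 hl).trans (by
      have := hkey 6 _ (by linarith) (by linarith : 6 * s⁻¹ ≤ 6 * rate ε n)
      linarith)) k hk
  rwa [← mul_assoc] at hmain

end Rate

/-! ### Quantile functions of laws on the unit interval -/

section Quantile

/-- The quantile function of a law on `[0, 1]`. -/
noncomputable def quantile (μ : Measure ℝ) (t : ℝ) : ℝ :=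
  sInf {x ∈ Set.Icc (0 : ℝ) 1 | min t 1 ≤ μ.real (Set.Iic x)}

/-- The quantile function of the limit law. -/
noncomputable def limitQuantile (q t : ℝ) : ℝ := min (t / (1 - q)) 1

variable {μ : Measure ℝ}

theorem bddBelow_quantile_set (t : ℝ) :
    BddBelow {x ∈ Set.Icc (0 : ℝ) 1 | min t 1 ≤ μ.real (Set.Iic x)} :=
  ⟨0, fun _ hx => hx.1.1⟩

/-- Truncating `t` at `1` keeps the set nonempty for every real `t`, so that the quantile function
is monotone, hence measurable, on the whole line. -/
theorem nonempty_quantile_set (h1 : μ.real (Set.Iic 1) = 1) (t : ℝ) :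
    {x ∈ Set.Icc (0 : ℝ) 1 | min t 1 ≤ μ.real (Set.Iic x)}.Nonempty :=
  ⟨1, ⟨zero_le_one, le_rfl⟩, by rw [h1]; exact min_le_right _ _⟩

theorem quantile_mem_Icc (h1 : μ.real (Set.Iic 1) = 1) (t : ℝ) :
    quantile μ t ∈ Set.Icc (0 : ℝ) 1 := by
  refine ⟨le_csInf (nonempty_quantile_set h1 t) fun x hx => hx.1.1, ?_⟩
  exact csInf_le (bddBelow_quantile_set t)
    ⟨⟨zero_le_one, le_rfl⟩, by rw [h1]; exact min_le_right _ _⟩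

theorem monotone_quantile (h1 : μ.real (Set.Iic 1) = 1) : Monotone (quantile μ) := by
  intro s t hst
  refine csInf_le_csInf (bddBelow_quantile_set s) (nonempty_quantile_set h1 t) fun x hx => ?_
  exact ⟨hx.1, (min_le_min_right 1 hst).trans hx.2⟩

variable [IsProbabilityMeasure μ]

/-- Right continuity of the distribution function lets the inequality pass to the infimum. -/
theorem le_measureReal_Iic_quantile (h1 : μ.real (Set.Iic 1) = 1) {t : ℝ} (ht : t ≤ 1) :
    t ≤ μ.real (Set.Iic (quantile μ t)) := by
  have hc : ContinuousWithinAt (cdf μ) (Set.Ioi (quantile μ t)) (quantile μ t) :=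
    ((cdf μ).right_continuous _).mono Set.Ioi_subset_Ici_self
  rw [← cdf_eq_real]
  refine ge_of_tendsto hc ?_
  filter_upwards [self_mem_nhdsWithin] with y hy
  obtain ⟨z, hz, hzy⟩ := exists_lt_of_csInf_lt (nonempty_quantile_set h1 t) hy
  rw [cdf_eq_real]
  have h2 := hz.2
  rw [min_eq_left ht] at h2
  exact h2.trans (measureReal_mono (Set.Iic_subset_Iic.2 hzy.le))

theorem quantile_le_iff (h1 : μ.real (Set.Iic 1) = 1) {t x : ℝ} (ht : t ≤ 1)
    (hx : x ∈ Set.Icc (0 : ℝ) 1) : quantile μ t ≤ x ↔ t ≤ μ.real (Set.Iic x) := by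
  constructor
  · intro h
    exact (le_measureReal_Iic_quantile h1 ht).trans (measureReal_mono (Set.Iic_subset_Iic.2 h))
  · intro h
    exact csInf_le (bddBelow_quantile_set t) ⟨hx, (min_le_left _ _).trans h⟩

theorem isProbabilityMeasure_restrict_Ioc :
    IsProbabilityMeasure (volume.restrict (Set.Ioc (0 : ℝ) 1)) :=
  ⟨by simp⟩

theorem map_quantile (h1 : μ.real (Set.Iic 1) = 1) (h0 : ∀ x < 0, μ.real (Set.Iic x) = 0) :
    (volume.restrict (Set.Ioc (0 : ℝ) 1)).map (quantile μ) = μ := by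
  have := isProbabilityMeasure_restrict_Ioc
  have hmeas := (monotone_quantile h1).measurable
  have : IsProbabilityMeasure ((volume.restrict (Set.Ioc (0 : ℝ) 1)).map (quantile μ)) :=
    Measure.isProbabilityMeasure_map hmeas.aemeasurable
  refine Measure.ext_of_Iic _ _ fun x => ?_
  rw [Measure.map_apply hmeas measurableSet_Iic,
    Measure.restrict_apply (hmeas measurableSet_Iic), ← ofReal_measureReal (μ := μ)]
  rcases lt_or_ge x 0 with hx | hx
  · have : quantile μ ⁻¹' Set.Iic x ∩ Set.Ioc 0 1 = ∅ := by
      ext t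
      simp only [Set.mem_inter_iff, Set.mem_preimage, Set.mem_Iic, Set.mem_empty_iff_false,
        iff_false, not_and]
      intro h
      have := (quantile_mem_Icc h1 t).1
      linarith
    rw [this, h0 x hx]
    simp
  rcases le_or_gt x 1 with hx1 | hx1
  · have hF : μ.real (Set.Iic x) ≤ 1 := measureReal_le_one
    have : quantile μ ⁻¹' Set.Iic x ∩ Set.Ioc 0 1 = Set.Ioc 0 (μ.real (Set.Iic x)) := by
      ext t
      simp only [Set.mem_inter_iff, Set.mem_preimage, Set.mem_Iic, Set.mem_Ioc]
      constructor
      · rintro ⟨h, h2, h3⟩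
        exact ⟨h2, (quantile_le_iff h1 h3 ⟨hx, hx1⟩).1 h⟩
      · rintro ⟨h2, h3⟩
        exact ⟨(quantile_le_iff h1 (h3.trans hF) ⟨hx, hx1⟩).2 h3, h2, h3.trans hF⟩
    rw [this, Real.volume_Ioc, sub_zero]
  · have : quantile μ ⁻¹' Set.Iic x ∩ Set.Ioc 0 1 = Set.Ioc 0 1 := by
      ext t
      simp only [Set.mem_inter_iff, Set.mem_preimage, Set.mem_Iic, Set.mem_Ioc, and_iff_right_iff_imp]
      intro _
      exact (quantile_mem_Icc h1 t).2.trans hx1.le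
    have h2 : μ.real (Set.Iic x) = 1 := by
      refine le_antisymm measureReal_le_one ?_
      rw [← h1]
      exact measureReal_mono (Set.Iic_subset_Iic.2 hx1.le)
    rw [this, h2, Real.volume_Ioc, sub_zero]

theorem measurable_limitQuantile (q : ℝ) : Measurable (limitQuantile q) := by
  unfold limitQuantile
  fun_prop

theorem limitQuantile_mem_Icc {q t : ℝ} (hq : q < 1) (ht : 0 ≤ t) :
    limitQuantile q t ∈ Set.Icc (0 : ℝ) 1 :=
  ⟨le_min (div_nonneg ht (by linarith)) zero_le_one, min_le_right _ _⟩

theorem map_limitQuantile {p₁ : ℝ≥0∞} (hp₁ : p₁ < 1) :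
    (volume.restrict (Set.Ioc (0 : ℝ) 1)).map (limitQuantile p₁.toReal) =
      (limitLaw p₁ hp₁.le : Measure ℝ) := by
  have := isProbabilityMeasure_restrict_Ioc
  have hmeas := measurable_limitQuantile p₁.toReal
  have : IsProbabilityMeasure
      ((volume.restrict (Set.Ioc (0 : ℝ) 1)).map (limitQuantile p₁.toReal)) :=
    Measure.isProbabilityMeasure_map hmeas.aemeasurable
  refine Measure.ext_of_Iic _ _ fun x => ?_
  set q := p₁.toReal with hq
  have hq1 : q < 1 := by
    have := (ENNReal.toReal_lt_toReal hp₁.ne_top ENNReal.one_ne_top).2 hp₁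
    simpa using this
  have hq0 : 0 ≤ q := ENNReal.toReal_nonneg
  have hpq : 1 - p₁ = ENNReal.ofReal (1 - q) := by
    rw [ENNReal.ofReal_sub _ hq0, ENNReal.ofReal_one, hq, ENNReal.ofReal_toReal hp₁.ne_top]
  have hr : (limitLaw p₁ hp₁.le : Measure ℝ) (Set.Iic x) =
      p₁ * (Set.Iic x).indicator 1 1 + (1 - p₁) * volume (Set.Iic x ∩ Set.Ico (0 : ℝ) 1) := by
    change (p₁ • Measure.dirac (1 : ℝ) + (1 - p₁) • volume.restrict (Set.Ico 0 1) : Measure ℝ)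
      (Set.Iic x) = _
    rw [Measure.add_apply, Measure.smul_apply, Measure.smul_apply, smul_eq_mul, smul_eq_mul,
      Measure.dirac_apply' _ measurableSet_Iic, Measure.restrict_apply measurableSet_Iic]
  rw [hr, Measure.map_apply hmeas measurableSet_Iic,
    Measure.restrict_apply (hmeas measurableSet_Iic)]
  rcases lt_or_ge x 0 with hx | hx
  · have h1 : limitQuantile q ⁻¹' Set.Iic x ∩ Set.Ioc 0 1 = ∅ := by
      ext t
      simp only [Set.mem_inter_iff, Set.mem_preimage, Set.mem_Iic, Set.mem_empty_iff_false,
        iff_false, not_and, Set.mem_Ioc]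
      intro h h2
      have := (limitQuantile_mem_Icc hq1 h2.le).1
      linarith
    have h2 : Set.Iic x ∩ Set.Ico (0 : ℝ) 1 = ∅ := by
      ext t
      simp only [Set.mem_inter_iff, Set.mem_Iic, Set.mem_Ico, Set.mem_empty_iff_false, iff_false,
        not_and]
      intro h h2
      linarith
    have h3 : (1 : ℝ) ∉ Set.Iic x := by simp; linarith
    rw [h1, h2, Set.indicator_of_notMem h3]
    simp
  rcases lt_or_ge x 1 with hx1 | hx1
  · have h1 : limitQuantile q ⁻¹' Set.Iic x ∩ Set.Ioc 0 1 = Set.Ioc 0 ((1 - q) * x) := by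
      ext t
      simp only [limitQuantile, Set.mem_inter_iff, Set.mem_preimage, Set.mem_Iic, Set.mem_Ioc,
        min_le_iff, div_le_iff₀ (by linarith : 0 < 1 - q)]
      constructor
      · rintro ⟨h | h, h2, h3⟩
        · exact ⟨h2, by linarith⟩
        · linarith
      · rintro ⟨h, h2⟩
        refine ⟨Or.inl (by linarith), h, ?_⟩
        nlinarith
    have h2 : Set.Iic x ∩ Set.Ico (0 : ℝ) 1 = Set.Icc 0 x := by
      ext t
      simp only [Set.mem_inter_iff, Set.mem_Iic, Set.mem_Ico, Set.mem_Icc]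
      constructor
      · tauto
      · rintro ⟨h, h2⟩
        exact ⟨h2, h, by linarith⟩
    have h3 : (1 : ℝ) ∉ Set.Iic x := by simp; linarith
    rw [h1, h2, Set.indicator_of_notMem h3, Real.volume_Ioc, Real.volume_Icc, mul_zero, zero_add,
      sub_zero, sub_zero, hpq, ENNReal.ofReal_mul (by linarith)]
  · have h1 : limitQuantile q ⁻¹' Set.Iic x ∩ Set.Ioc 0 1 = Set.Ioc 0 1 := by
      ext t
      simp only [Set.mem_inter_iff, Set.mem_preimage, Set.mem_Iic, Set.mem_Ioc,
        and_iff_right_iff_imp]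
      intro h
      exact (limitQuantile_mem_Icc hq1 h.1.le).2.trans hx1
    have h2 : Set.Iic x ∩ Set.Ico (0 : ℝ) 1 = Set.Ico 0 1 := by
      ext t
      simp only [Set.mem_inter_iff, Set.mem_Iic, Set.mem_Ico, and_iff_right_iff_imp]
      intro h
      linarith
    have h3 : (1 : ℝ) ∈ Set.Iic x := hx1
    rw [h1, h2, Set.indicator_of_mem h3, Real.volume_Ioc, Real.volume_Ico]
    simp [add_tsub_cancel_of_le hp₁.le]

/-- Vertical errors `δ` become horizontal errors `δ / (1 - q)`, the limit distribution function
having slope `1 - q` before its jump. Near `1` no upper bound is needed: an atom slightly to the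
left of `1` is misplaced by at most `η`. -/
theorem abs_quantile_sub_limitQuantile_le (h1 : μ.real (Set.Iic 1) = 1) {q δ η : ℝ} (hq : q < 1)
    (hδ : 0 ≤ δ) (hη : 0 ≤ η)
    (hlow : ∀ x ∈ Set.Icc (0 : ℝ) 1, (1 - q) * x - δ ≤ μ.real (Set.Iic x))
    (hup : ∀ x ∈ Set.Icc (0 : ℝ) 1, x < 1 - η → μ.real (Set.Iic x) ≤ (1 - q) * x + δ)
    {t : ℝ} (ht0 : 0 ≤ t) (ht : t ≤ 1) :
    |quantile μ t - limitQuantile q t| ≤ δ / (1 - q) + η := by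
  have hq' : 0 < 1 - q := by linarith
  have hδq : 0 ≤ δ / (1 - q) := div_nonneg hδ hq'.le
  have hX := quantile_mem_Icc h1 t
  have hg := limitQuantile_mem_Icc hq ht0
  rw [abs_le]
  constructor
  · rcases lt_or_ge (quantile μ t) (1 - η) with h | h
    · have h2 := (le_measureReal_Iic_quantile h1 ht).trans (hup _ hX h)
      have h3 : t / (1 - q) ≤ quantile μ t + δ / (1 - q) := by
        rw [div_le_iff₀ hq', add_mul, div_mul_cancel₀ _ hq'.ne']
        linarith
      have h4 : limitQuantile q t ≤ t / (1 - q) := min_le_left _ _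
      linarith
    · linarith [hg.2]
  · rcases lt_or_ge (limitQuantile q t + δ / (1 - q)) 1 with h | h
    · have h2 : limitQuantile q t = t / (1 - q) := by
        refine min_eq_left ?_
        by_contra hcon
        have h3 : limitQuantile q t = 1 := min_eq_right (not_le.1 hcon).le
        linarith
      have hx : limitQuantile q t + δ / (1 - q) ∈ Set.Icc (0 : ℝ) 1 := ⟨by linarith [hg.1], h.le⟩
      have h3 := hlow _ hx
      have h4 : (1 - q) * (limitQuantile q t + δ / (1 - q)) - δ = t := by
        rw [h2]; field_simp; ring
      rw [h4] at h3
      have := (quantile_le_iff h1 ht hx).2 h3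
      linarith
    · linarith [hX.2]

/-- Feeding the same uniform variable to both quantile functions gives a coupling whose `L²` cost is
at most its uniform cost. -/
theorem wasserstein2_le {p₁ : ℝ≥0∞} (hp₁ : p₁ < 1) (h1 : μ.real (Set.Iic 1) = 1)
    (h0 : ∀ x < 0, μ.real (Set.Iic x) = 0) {θ : ℝ}
    (hθ : ∀ t ∈ Set.Ioc (0 : ℝ) 1, |quantile μ t - limitQuantile p₁.toReal t| ≤ θ) :
    wasserstein2 μ (limitLaw p₁ hp₁.le : Measure ℝ) ≤ ENNReal.ofReal θ := by
  have hm1 := (monotone_quantile h1).measurable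
  have hm2 := measurable_limitQuantile p₁.toReal
  have hm : Measurable fun t => (quantile μ t, limitQuantile p₁.toReal t) := hm1.prodMk hm2
  have hθ0 : 0 ≤ θ := (abs_nonneg _).trans (hθ 1 ⟨one_pos, le_rfl⟩)
  have := isProbabilityMeasure_restrict_Ioc
  let π := (volume.restrict (Set.Ioc (0 : ℝ) 1)).map
    fun t => (quantile μ t, limitQuantile p₁.toReal t)
  have hπ : π ∈ couplings μ (limitLaw p₁ hp₁.le : Measure ℝ) := by
    constructor
    · rw [Measure.fst_map_prodMk hm2, map_quantile h1 h0]
    · rw [Measure.snd_map_prodMk hm1, map_limitQuantile hp₁]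
  refine (iInf₂_le π hπ).trans ?_
  have hint : ∫⁻ z, ENNReal.ofReal (|z.1 - z.2| ^ 2) ∂π ≤ ENNReal.ofReal θ ^ 2 := by
    rw [lintegral_map (by fun_prop) hm]
    calc ∫⁻ t in Set.Ioc (0 : ℝ) 1,
          ENNReal.ofReal (|quantile μ t - limitQuantile p₁.toReal t| ^ 2)
        ≤ ∫⁻ _ in Set.Ioc (0 : ℝ) 1, ENNReal.ofReal θ ^ 2 := by
          refine setLIntegral_mono (by fun_prop) fun t ht => ?_
          rw [← ENNReal.ofReal_pow hθ0]
          exact ENNReal.ofReal_le_ofReal (pow_le_pow_left₀ (abs_nonneg _) (hθ t ht) 2)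
      _ = ENNReal.ofReal θ ^ 2 := by simp
  calc (∫⁻ z, ENNReal.ofReal (|z.1 - z.2| ^ 2) ∂π) ^ (1 / 2 : ℝ)
      ≤ (ENNReal.ofReal θ ^ 2) ^ (1 / 2 : ℝ) := by gcongr
    _ = ENNReal.ofReal θ := by
      rw [← ENNReal.rpow_natCast, ← ENNReal.rpow_mul]
      norm_num

end Quantile

/-! ### The normalized length of the standard right factor -/

section RightFactor

variable {A : Type*} [LinearOrder A] {p : PMF A} {a : A}

theorem measurable_normalizedLength : Measurable (normalizedLength : List A → ℝ) :=
  fun _ _ => measurableSet_words _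

theorem rightFactorLaw_coe (n : ℕ) :
    (rightFactorLaw p n : Measure ℝ) = (lyndonMeasure p n).map normalizedLength := rfl

theorem ae_lyndonMeasure_mem (n : ℕ) : ∀ᵐ w ∂(lyndonMeasure p n), w ∈ lyndonWords A n :=
  ae_cond_mem (measurableSet_words _)

theorem length_standardRightFactor_le {w : List A} (hw : 2 ≤ w.length) :
    (standardRightFactor w).length ≤ w.length :=
  (isLeast_standardRightFactor hw).1.1.length_le

theorem rightFactorLaw_Iic {n : ℕ} (hn : 2 ≤ n) {x : ℝ} (hx : 0 ≤ x) :
    (rightFactorLaw p n : Measure ℝ).real (Set.Iic x) =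
      (lyndonMeasure p n).real {w | (standardRightFactor w).length ≤ ⌊x * n⌋₊} := by
  have hn0 : (0 : ℝ) < n := by exact_mod_cast (by omega : 0 < n)
  rw [rightFactorLaw_coe, measureReal_def, Measure.map_apply measurable_normalizedLength
    measurableSet_Iic, measureReal_def]
  congr 1
  refine measure_congr ?_
  filter_upwards [ae_lyndonMeasure_mem n] with w hw
  refine propext ?_
  change normalizedLength w ≤ x ↔ (standardRightFactor w).length ≤ ⌊x * n⌋₊
  rw [normalizedLength, hw.1, div_le_iff₀ hn0, Nat.le_floor_iff (by positivity)]

theorem rightFactorLaw_Iic_one (ha : ∀ b, a ≤ b) (hpos : 0 < p a) (hlt : p a < 1) {n : ℕ}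
    (hn : 2 ≤ n) : (rightFactorLaw p n : Measure ℝ).real (Set.Iic 1) = 1 := by
  have := isProbabilityMeasure_lyndonMeasure ha hpos hlt (n := n) (by omega)
  rw [rightFactorLaw_Iic hn zero_le_one, one_mul, Nat.floor_natCast,
    ← probReal_univ (μ := lyndonMeasure p n), measureReal_def, measureReal_def]
  congr 1
  refine measure_congr ?_
  filter_upwards [ae_lyndonMeasure_mem n] with w hw
  refine propext (iff_of_true ?_ trivial)
  change (standardRightFactor w).length ≤ n
  have h := length_standardRightFactor_le (w := w) (by rw [hw.1]; exact hn)
  rwa [hw.1] at h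

theorem rightFactorLaw_Iic_neg (n : ℕ) {x : ℝ} (hx : x < 0) :
    (rightFactorLaw p n : Measure ℝ).real (Set.Iic x) = 0 := by
  rw [rightFactorLaw_coe, measureReal_def, Measure.map_apply measurable_normalizedLength
    measurableSet_Iic]
  have : (normalizedLength : List A → ℝ) ⁻¹' Set.Iic x = ∅ := by
    ext w
    simp only [Set.mem_preimage, Set.mem_Iic, Set.mem_empty_iff_false, iff_false, not_le]
    have : 0 ≤ normalizedLength w := by unfold normalizedLength; positivity
    linarith
  rw [this]
  simp

theorem isProbabilityMeasure_rightFactorLaw (ha : ∀ b, a ≤ b) (hpos : 0 < p a) (hlt : p a < 1)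
    {n : ℕ} (hn : 1 ≤ n) : IsProbabilityMeasure (rightFactorLaw p n : Measure ℝ) := by
  have := isProbabilityMeasure_lyndonMeasure ha hpos hlt hn
  rw [rightFactorLaw_coe]
  exact Measure.isProbabilityMeasure_map measurable_normalizedLength.aemeasurable

theorem exists_quantile_bound (ha : ∀ b, a ≤ b) (hpos : 0 < p a) (hlt : p a < 1) {ε : ℝ}
    (hε : 0 < ε) (hε1 : ε < 1 / 2) :
    ∃ K : ℝ, 0 ≤ K ∧ ∀ᶠ n : ℕ in atTop, ∀ t ∈ Set.Ioc (0 : ℝ) 1,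
      |quantile (rightFactorLaw p n : Measure ℝ) t - limitQuantile (p a).toReal t| ≤
        K * rate ε n := by
  have hq1 : (p a).toReal < 1 := by
    have := (ENNReal.toReal_lt_toReal (p.apply_ne_top a) ENNReal.one_ne_top).2 hlt
    simpa using this
  obtain ⟨K, hK, hbound⟩ := exists_length_bounds ha hpos hlt hε hε1
  have hq0 : 0 ≤ (p a).toReal := ENNReal.toReal_nonneg
  set q := (p a).toReal
  have hq' : 0 < 1 - q := by linarith
  refine ⟨(K + 1) / (1 - q) + 1, by positivity, ?_⟩
  filter_upwards [hbound, eventually_log_ge 1, eventually_ge_atTop 2] with n hb hL hn t ht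
  have hn1 : (1 : ℝ) ≤ n := by exact_mod_cast (by omega : 1 ≤ n)
  have hn0 : (0 : ℝ) < n := by linarith
  have hP := isProbabilityMeasure_rightFactorLaw ha hpos hlt (n := n) (by omega)
  have hinv : 1 / (n : ℝ) ≤ rate ε n := by
    refine le_trans ?_ (inv_sqrt_mul_log_le_rate hε (by omega))
    refine le_trans ?_ (le_mul_of_one_le_right (by positivity) hL)
    rw [← one_div]
    refine one_div_le_one_div_of_le (Real.sqrt_pos.2 hn0) ?_
    rw [Real.sqrt_le_left (by linarith)]
    nlinarith
  have hr0 : 0 < rate ε n := lt_of_lt_of_le (by positivity) hinv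
  have hfloor : ∀ x ∈ Set.Icc (0 : ℝ) 1, ⌊x * n⌋₊ ≤ n := by
    intro x hx
    refine Nat.floor_le_of_le ?_
    exact mul_le_of_le_one_left hn0.le hx.2
  -- The `1 / n` in `δ` pays for rounding `x * n` down to an integer; `η = 1 / n` because the atom
  -- of the discrete law sits at `1 - 1 / n`.
  have hmain := abs_quantile_sub_limitQuantile_le (μ := (rightFactorLaw p n : Measure ℝ))
    (rightFactorLaw_Iic_one ha hpos hlt hn) (q := q) (δ := K * rate ε n + 1 / n) (η := 1 / n) hq1
    (by positivity) (by positivity) ?_ ?_ ht.1.le ht.2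
  · refine hmain.trans ?_
    rw [add_mul, one_mul, div_mul_eq_mul_div, add_mul, one_mul]
    gcongr
  · intro x hx
    rw [rightFactorLaw_Iic hn hx.1]
    refine le_trans ?_ (hb _ (hfloor x hx)).2
    have h1 : x - 1 / n ≤ (⌊x * n⌋₊ : ℝ) / n := by
      rw [le_div_iff₀ hn0, sub_mul, one_div, inv_mul_cancel₀ hn0.ne']
      linarith [Nat.lt_floor_add_one (x * n)]
    have h2 := mul_le_mul_of_nonneg_left h1 hq'.le
    have h3 : (1 - q) * (1 / n) ≤ 1 / n := mul_le_of_le_one_left (by positivity) (by linarith)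
    linarith
  · intro x hx hxn
    rw [rightFactorLaw_Iic hn hx.1]
    have hfl := Nat.floor_le (mul_nonneg hx.1 hn0.le)
    have hk : ⌊x * n⌋₊ + 1 < n := by
      have h1 : x * n < (1 - 1 / n) * n := mul_lt_mul_of_pos_right hxn hn0
      rw [sub_mul, one_div, inv_mul_cancel₀ hn0.ne'] at h1
      have h2 : ((⌊x * n⌋₊ + 1 : ℕ) : ℝ) < n := by push_cast; linarith
      exact_mod_cast h2
    refine ((hb _ (hfloor x hx)).1 hk).trans ?_
    have h1 : (⌊x * n⌋₊ : ℝ) / n ≤ x := by rw [div_le_iff₀ hn0]; exact hfl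
    have h2 := mul_le_mul_of_nonneg_left h1 hq'.le
    have h3 : 0 ≤ 1 / (n : ℝ) := by positivity
    linarith

/-- No boundedness of `f` is needed: the quantiles stay in `[0, 1]`, where `f` is bounded, and they
converge pointwise. Powers are thus covered as well. -/
theorem tendsto_integral_rightFactorLaw (ha : ∀ b, a ≤ b) (hpos : 0 < p a) (hlt : p a < 1)
    {f : ℝ → ℝ} (hf : Continuous f) :
    Tendsto (fun n : ℕ => ∫ x, f x ∂(rightFactorLaw p n : Measure ℝ)) atTop
      (𝓝 (∫ x, f x ∂(limitLaw (p a) hlt.le : Measure ℝ))) := by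
  obtain ⟨K, -, hb⟩ := exists_quantile_bound ha hpos hlt (ε := 1 / 4) (by norm_num) (by norm_num)
  have := isProbabilityMeasure_restrict_Ioc
  obtain ⟨M, hM⟩ := (isCompact_Icc (a := (0 : ℝ)) (b := 1)).exists_bound_of_continuousOn
    hf.continuousOn
  have hmeas : ∀ᶠ n : ℕ in atTop, Measurable (quantile (rightFactorLaw p n : Measure ℝ)) ∧
      (∀ t, quantile (rightFactorLaw p n : Measure ℝ) t ∈ Set.Icc (0 : ℝ) 1) ∧
      ∫ x, f x ∂(rightFactorLaw p n : Measure ℝ) =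
        ∫ t in Set.Ioc (0 : ℝ) 1, f (quantile (rightFactorLaw p n : Measure ℝ) t) := by
    filter_upwards [eventually_ge_atTop 2] with n hn
    have := isProbabilityMeasure_rightFactorLaw ha hpos hlt (n := n) (by omega)
    have h1 := rightFactorLaw_Iic_one ha hpos hlt hn
    have h2 := (monotone_quantile h1).measurable
    refine ⟨h2, quantile_mem_Icc h1, ?_⟩
    conv_lhs => rw [← map_quantile h1 fun x hx => rightFactorLaw_Iic_neg n hx]
    rw [integral_map h2.aemeasurable hf.aestronglyMeasurable]
  rw [← map_limitQuantile hlt, integral_map (measurable_limitQuantile _).aemeasurable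
    hf.aestronglyMeasurable]
  refine Tendsto.congr' (hmeas.mono fun n hn => hn.2.2.symm) ?_
  refine tendsto_integral_filter_of_dominated_convergence (fun _ => M) ?_ ?_ ?_ ?_
  · exact hmeas.mono fun n hn => hf.comp_aestronglyMeasurable hn.1.aestronglyMeasurable
  · exact hmeas.mono fun n hn => ae_of_all _ fun t => hM _ (hn.2.1 t)
  · exact integrable_const M
  · filter_upwards [ae_restrict_mem measurableSet_Ioc] with t ht
    refine (hf.tendsto _).comp ?_
    rw [tendsto_iff_dist_tendsto_zero]
    have hr := (tendsto_rate (ε := 1 / 4) (by norm_num)).const_mul K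
    rw [mul_zero] at hr
    exact squeeze_zero' (Eventually.of_forall fun _ => dist_nonneg)
      (hb.mono fun n hn => hn t ht) hr

theorem exists_wasserstein2_le (ha : ∀ b, a ≤ b) (hpos : 0 < p a) (hlt : p a < 1) {ε : ℝ}
    (hε : 0 < ε) (hε1 : ε < 1 / 2) : ∃ C : ℝ, ∀ n : ℕ, 2 ≤ n →
      wasserstein2 (rightFactorLaw p n : Measure ℝ) (limitLaw (p a) hlt.le : Measure ℝ) ≤
        ENNReal.ofReal (C * rate ε n) := by
  obtain ⟨K, hK, hb⟩ := exists_quantile_bound ha hpos hlt hε hε1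
  obtain ⟨N, hN⟩ := eventually_atTop.1 hb
  have hq1 : (p a).toReal < 1 := by
    have := (ENNReal.toReal_lt_toReal (p.apply_ne_top a) ENNReal.one_ne_top).2 hlt
    simpa using this
  have hr0 : ∀ n : ℕ, 0 ≤ rate ε n := fun n =>
    mul_nonneg (Real.rpow_nonneg (Nat.cast_nonneg n) _) (Real.log_natCast_nonneg n)
  have hsum : 0 ≤ ∑ k ∈ Finset.range N, (rate ε k)⁻¹ :=
    Finset.sum_nonneg fun k _ => inv_nonneg.2 (hr0 k)
  -- For the finitely many `n < N`, the added sum makes the bound at least `1`, which exceeds any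
  -- distance between points of `[0, 1]`. The terms `k = 0` and `k = 1`, where the rate vanishes,
  -- contribute `0`.
  refine ⟨K + ∑ k ∈ Finset.range N, (rate ε k)⁻¹, fun n hn => ?_⟩
  have := isProbabilityMeasure_rightFactorLaw ha hpos hlt (n := n) (by omega)
  have h1 := rightFactorLaw_Iic_one ha hpos hlt hn
  refine wasserstein2_le hlt h1 (fun x hx => rightFactorLaw_Iic_neg n hx) fun t ht => ?_
  rw [add_mul]
  rcases le_or_gt N n with h | h
  · exact (hN n h t ht).trans (le_add_of_nonneg_right (mul_nonneg hsum (hr0 n)))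
  · have hn1 : (1 : ℝ) < n := by exact_mod_cast (by omega : 1 < n)
    have hpos' : 0 < rate ε n :=
      mul_pos (Real.rpow_pos_of_pos (by linarith) _) (Real.log_pos hn1)
    have h2 : 1 ≤ (∑ k ∈ Finset.range N, (rate ε k)⁻¹) * rate ε n := by
      calc 1 = (rate ε n)⁻¹ * rate ε n := (inv_mul_cancel₀ hpos'.ne').symm
        _ ≤ _ := mul_le_mul_of_nonneg_right (Finset.single_le_sum
          (f := fun k => (rate ε k)⁻¹) (fun k _ => inv_nonneg.2 (hr0 k))
            (Finset.mem_range.2 h)) hpos'.le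
    have h3 := quantile_mem_Icc h1 t
    have h4 := limitQuantile_mem_Icc hq1 ht.1.le
    refine le_trans ?_ (h2.trans (le_add_of_nonneg_left (mul_nonneg hK (hr0 n))))
    rw [abs_le]
    constructor <;> linarith [h3.1, h3.2, h4.1, h4.2]

end RightFactor

end LyndonWord

theorem mainTheorem3 {A : Type*} [LinearOrder A] (p : PMF A) (a₁ : A) (ha₁ : ∀ a : A, a₁ ≤ a)
    (hpos : 0 < p a₁) (hlt : p a₁ < 1) :
    -- for `n ≥ 1`, a random Lyndon word with `n` letters is well defined
    (∀ n : ℕ, 1 ≤ n → IsProbabilityMeasure (LyndonWord.lyndonMeasure p n)) ∧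
    -- convergence in law, i.e. in the topology of weak convergence
    Tendsto (fun n : ℕ => LyndonWord.rightFactorLaw p n) atTop
      (𝓝 (LyndonWord.limitLaw (p a₁) hlt.le)) ∧
    -- convergence of the moments
    (∀ k : ℕ, Tendsto (fun n : ℕ =>
        ∫ w, LyndonWord.normalizedLength w ^ k ∂(LyndonWord.lyndonMeasure p n)) atTop
      (𝓝 (∫ x : ℝ, x ^ k ∂(LyndonWord.limitLaw (p a₁) hlt.le : Measure ℝ)))) ∧
    -- rate of convergence for the Wasserstein distance
    (∀ ε : ℝ, 0 < ε → ε < 1 / 2 → ∃ C : ℝ, ∀ n : ℕ, 2 ≤ n →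
      LyndonWord.wasserstein2 (LyndonWord.rightFactorLaw p n : Measure ℝ)
          (LyndonWord.limitLaw (p a₁) hlt.le : Measure ℝ) ≤
        ENNReal.ofReal (C * ((n : ℝ) ^ (-(1 / 2) + ε) * Real.log n))) := by
  refine ⟨fun n hn => LyndonWord.isProbabilityMeasure_lyndonMeasure ha₁ hpos hlt hn, ?_, ?_, ?_⟩
  · rw [FiniteMeasure.tendsto_iff_forall_integral_tendsto]
    exact fun f => LyndonWord.tendsto_integral_rightFactorLaw ha₁ hpos hlt f.continuous
  · intro k
    refine (LyndonWord.tendsto_integral_rightFactorLaw ha₁ hpos hlt (continuous_pow k)).congr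
      fun n => ?_
    rw [LyndonWord.rightFactorLaw_coe, integral_map
      LyndonWord.measurable_normalizedLength.aemeasurable
      (continuous_pow k).aestronglyMeasurable]
  · intro ε hε hε1
    exact LyndonWord.exists_wasserstein2_le ha₁ hpos hlt hε hε1
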